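/- Let $G$ be a second countable locally compact (Hausdorff) group with a left Haar measure $ds$ and modular function $\Delta$, normalised by $\Delta(t)\int_G f(st)\,ds=\int_G f(s)\,ds$. Let $\mu$ be a Borel probability measure on $G$. Let $(\lambda_s f)(t)=f(s^{-1}t)$ and $(\rho_r f)(s)=\Delta(r)^{1/2}f(sr)$ be the left and right regular representations on $L^2(G)$, let $M_\phi$ be multiplication by $\phi\in L^\infty(G)$ on $L^2(G)$, and let $\mathrm{VN}(G)=\overline{\mathrm{span}}^{w^*}\{\lambda_s:s\in G\}\subseteq\mathcal B(L^2(G))$. Define $$\mathcal H(\mu)=\Big\{\phi\in L^\infty(G):\int_G\phi(st)\,d\mu(t)=\phi(s)\text{ for almost every }s\Big\},$$ $$\widetilde{\mathcal H}(\mu)=\{T\in\mathcal B(L^2(G)):\Theta(\mu)(T)=T\},\qquad \Theta(\mu)(T)=\int_G\rho_rT\rho_r^*\,d\mu(r)\ \text{(weak-* sense)},$$ $$\mathrm{Bim}(\mathcal H(\mu))=\overline{\mathrm{span}}^{w^*}\{AM_\phi B: A,B\in \mathrm{VN}(G),\ \phi\in\mathcal H(\mu)\}.$$ Let $\alpha$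 be the action of $G$ on $\mathcal H(\mu)$ by left translation, $(\alpha_s\phi)(t)=\phi(s^{-1}t)$. For $\phi\in\mathcal H(\mu)$ let $\tilde\alpha(\phi)=(\alpha_s^{-1}\phi)_{s\in G}$, that is, the operator on $L^2(G)\otimes L^2(G)=L^2(G\times G)$ of multiplication by $(s,t)\mapsto\phi(st)$. The crossed product is $$G\rtimes_\alpha\mathcal H(\mu)=\overline{\mathrm{span}}^{w^*}\{\tilde\alpha(\phi)(\lambda_s\otimes I):\phi\in\mathcal H(\mu),\ s\in G\}\subseteq\mathcal B(L^2(G\times G)).$$ Let $V$ be the unitary $(V\xi)(s,t)=\xi(st,t)\Delta(t)^{1/2}$ on $L^2(G\times G)$, and let $\tilde\Gamma(T)=V(T\otimes I)V^*$ for $T\in\mathcal B(L^2(G))$. Then $$\tilde\Gamma\big(\mathrm{Bim}(\mathcal H(\mu))\big)=G\rtimes_\alpha\mathcal H(\mu),$$ and in particular $$G\rtimes_\alpha\mathcal H(\mu)\subseteq\tilde\Gamma\big(\widetilde{\mathcal H}(\mu)\big).$$ -/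

import Mathlib

open MeasureTheory Measure Filter
open scoped ENNReal NNReal TensorProduct InnerProductSpace

noncomputable section

namespace HarmonicCrossed

section Generic

variable {E : Type*} [NormedAddCommGroup E] [InnerProductSpace ℂ E]

/-- The pairing of `T ∈ B(E)` with the trace class element `∑ₙ ξₙ ⊗ ηₙ^*`, where `∑ ‖ξₙ‖² < ∞` and
`∑ ‖ηₙ‖² < ∞`. All normal functionals on `B(E)` are of this form. -/
def tracePairing (T : E →L[ℂ] E) (ξ η : lp (fun _ : ℕ => E) 2) : ℂ :=
  ∑' n, ⟪η n, T (ξ n)⟫_ℂ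

/-- The weak-* (ultraweak) topology on `B(E)`: the coarsest one for which the pairings with all
trace class elements are continuous. -/
@[reducible] def weakStarTopology (E : Type*) [NormedAddCommGroup E] [InnerProductSpace ℂ E] :
    TopologicalSpace (E →L[ℂ] E) :=
  TopologicalSpace.induced
    (fun T (p : lp (fun _ : ℕ => E) 2 × lp (fun _ : ℕ => E) 2) => tracePairing T p.1 p.2)
    inferInstance

/-- The weak-* closure of a set of operators. -/
def weakStarClosure (S : Set (E →L[ℂ] E)) : Set (E →L[ℂ] E) :=
  @closure _ (weakStarTopology E) S

/-- The weak-* closed linear span of a set of operators. -/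
def weakStarSpan (S : Set (E →L[ℂ] E)) : Set (E →L[ℂ] E) :=
  weakStarClosure (Submodule.span ℂ S : Set (E →L[ℂ] E))

theorem summable_tracePairing (T : E →L[ℂ] E) (ξ η : lp (fun _ : ℕ => E) 2) :
    Summable fun n => ⟪η n, T (ξ n)⟫_ℂ := by
  have hsum : Summable fun n => ‖T‖ * (‖η n‖ * ‖ξ n‖) := by
    refine Summable.mul_left _ (lp.summable_mul ?_ η ξ)
    rw [Real.holderConjugate_iff]; norm_num
  refine hsum.of_norm_bounded fun n => (norm_inner_le_norm _ _).trans ?_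
  have := mul_le_mul_of_nonneg_left (T.le_opNorm (ξ n)) (norm_nonneg (η n))
  linarith

variable {X : Type*} [MeasurableSpace X] {ν : Measure X}

/-- The operator `M_φ` of multiplication by `φ ∈ L^∞(ν)` on `L²(ν)`. -/
def mulOp (φ : Lp ℂ ∞ ν) : Lp ℂ 2 ν →L[ℂ] Lp ℂ 2 ν :=
  (ContinuousLinearMap.mul ℂ ℂ).holderL ν ∞ 2 2 φ

theorem mulOp_coeFn (φ : Lp ℂ ∞ ν) (f : Lp ℂ 2 ν) :
    mulOp φ f =ᵐ[ν] fun x => φ x * f x :=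
  (ContinuousLinearMap.mul ℂ ℂ).coeFn_holder (r := 2) φ f

theorem eLpNorm_weightedComp {τ : X → X} {w : X → ℝ≥0} (hτ : QuasiMeasurePreserving τ ν ν)
    (hw : Measurable w) (h : map τ (ν.withDensity fun x => (w x : ℝ≥0∞) ^ 2) = ν)
    (f : X → ℂ) (hf : AEStronglyMeasurable f ν) :
    eLpNorm (fun x => ((w x : ℝ) : ℂ) * f (τ x)) 2 ν = eLpNorm f 2 ν := by
  have hfe : AEMeasurable (fun x => ‖f x‖ₑ ^ (2:ℝ)) ν := hf.enorm.pow_const _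
  rw [eLpNorm_eq_lintegral_rpow_enorm_toReal (by simp) (by simp),
    eLpNorm_eq_lintegral_rpow_enorm_toReal (by simp) (by simp)]
  congr 1
  have hw2 : Measurable fun x => (w x : ℝ≥0∞) ^ 2 := by fun_prop
  have hac : ν.withDensity (fun x => (w x : ℝ≥0∞) ^ 2) ≪ ν := withDensity_absolutelyContinuous _ _
  simp only [ENNReal.toReal_ofNat]
  conv_rhs => rw [← h]
  rw [lintegral_map' (by rwa [h]) hτ.measurable.aemeasurable,
    lintegral_withDensity_eq_lintegral_mul₀ hw2.aemeasurable
      (g := fun x => ‖f (τ x)‖ₑ ^ (2 : ℝ)) (hfe.comp_quasiMeasurePreserving hτ)]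
  refine lintegral_congr fun x => ?_
  have : ‖((w x : ℝ) : ℂ)‖ₑ = (w x : ℝ≥0∞) := by
    rw [← ofReal_norm]; simp
  simp only [Pi.mul_apply, enorm_mul, this]
  rw [ENNReal.mul_rpow_of_nonneg _ _ (by norm_num)]
  norm_num [Function.comp]

theorem memLp_weightedComp {τ : X → X} {w : X → ℝ≥0} (hτ : QuasiMeasurePreserving τ ν ν)
    (hw : Measurable w) (h : map τ (ν.withDensity fun x => (w x : ℝ≥0∞) ^ 2) = ν)
    (f : Lp ℂ 2 ν) : MemLp (fun x => ((w x : ℝ) : ℂ) * f (τ x)) 2 ν :=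
  ⟨(by fun_prop : Measurable fun x => ((w x : ℝ) : ℂ)).aestronglyMeasurable.mul
    ((Lp.memLp f).1.comp_quasiMeasurePreserving hτ), by
      rw [eLpNorm_weightedComp hτ hw h f (Lp.memLp f).1]; exact (Lp.memLp f).2⟩

/-- The isometry `f ↦ w · (f ∘ τ)` of `L²(ν)`, where `τ` maps the measure `w² ν` to `ν`. -/
def weightedComp (τ : X → X) (w : X → ℝ≥0) (hτ : QuasiMeasurePreserving τ ν ν)
    (hw : Measurable w) (h : map τ (ν.withDensity fun x => (w x : ℝ≥0∞) ^ 2) = ν) :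
    Lp ℂ 2 ν →L[ℂ] Lp ℂ 2 ν :=
  LinearMap.mkContinuous
    { toFun := fun f => (memLp_weightedComp hτ hw h f).toLp
      map_add' := fun f g => by
        ext1
        filter_upwards [MemLp.coeFn_toLp (memLp_weightedComp hτ hw h (f + g)),
          MemLp.coeFn_toLp (memLp_weightedComp hτ hw h f),
          MemLp.coeFn_toLp (memLp_weightedComp hτ hw h g),
          Lp.coeFn_add (memLp_weightedComp hτ hw h f).toLp (memLp_weightedComp hτ hw h g).toLp,
          hτ.ae (Lp.coeFn_add f g)] with x h1 h2 h3 h4 h5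
        rw [h1, h4, Pi.add_apply, h2, h3, h5, Pi.add_apply, mul_add]
      map_smul' := fun c f => by
        ext1
        filter_upwards [MemLp.coeFn_toLp (memLp_weightedComp hτ hw h (c • f)),
          MemLp.coeFn_toLp (memLp_weightedComp hτ hw h f),
          Lp.coeFn_smul c (memLp_weightedComp hτ hw h f).toLp,
          hτ.ae (Lp.coeFn_smul c f)] with x h1 h2 h4 h5
        rw [h1, RingHom.id_apply, h4, Pi.smul_apply, h2, h5, Pi.smul_apply, smul_eq_mul,
          smul_eq_mul, mul_left_comm] }
    1 fun f => by
      rw [one_mul, LinearMap.coe_mk, AddHom.coe_mk, Lp.norm_toLp,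
        eLpNorm_weightedComp hτ hw h f (Lp.memLp f).1, Lp.norm_def]

theorem weightedComp_coeFn {τ : X → X} {w : X → ℝ≥0} (hτ : QuasiMeasurePreserving τ ν ν)
    (hw : Measurable w) (h : map τ (ν.withDensity fun x => (w x : ℝ≥0∞) ^ 2) = ν)
    (f : Lp ℂ 2 ν) :
    weightedComp τ w hτ hw h f =ᵐ[ν] fun x => ((w x : ℝ) : ℂ) * f (τ x) :=
  MemLp.coeFn_toLp (memLp_weightedComp hτ hw h f)

theorem weightedComp_norm {τ : X → X} {w : X → ℝ≥0} (hτ : QuasiMeasurePreserving τ ν ν)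
    (hw : Measurable w) (h : map τ (ν.withDensity fun x => (w x : ℝ≥0∞) ^ 2) = ν)
    (f : Lp ℂ 2 ν) : ‖weightedComp τ w hτ hw h f‖ = ‖f‖ := by
  rw [Lp.norm_def, Lp.norm_def, eLpNorm_congr_ae (weightedComp_coeFn hτ hw h f),
    eLpNorm_weightedComp hτ hw h f (Lp.memLp f).1]

end Generic

section Tensor

theorem memLp_tensor {X : Type*} [MeasurableSpace X] (ν : Measure X) {f g : X → ℂ} (hf : MemLp f 2 ν) (hg : MemLp g 2 ν) :
    MemLp (fun p : X × X => f p.1 * g p.2) 2 (ν.prod ν) := by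
  rw [memLp_two_iff_integrable_sq_norm]
  · have := (hf.integrable_norm_pow (by norm_num)).mul_prod (hg.integrable_norm_pow (by norm_num))
    simpa [mul_pow] using this
  · exact hf.1.comp_fst.mul hg.1.comp_snd

/-- The elementary tensor `f ⊗ g`, i.e. the function `(s, t) ↦ f(s) g(t)` in `L²(ν × ν)`. -/
def tensorVec {X : Type*} [MeasurableSpace X] {ν : Measure X} (f g : Lp ℂ 2 ν) : Lp ℂ 2 (ν.prod ν) :=
  (memLp_tensor ν (Lp.memLp f) (Lp.memLp g)).toLp

theorem tensorVec_coeFn {X : Type*} [MeasurableSpace X] (ν : Measure X) (f g : Lp ℂ 2 ν) :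
    tensorVec f g =ᵐ[ν.prod ν] fun p => f p.1 * g p.2 :=
  MemLp.coeFn_toLp _

variable {X : Type*} [MeasurableSpace X] (ν : Measure X) [SigmaFinite ν]

theorem inner_tensorVec (f g f' g' : Lp ℂ 2 ν) :
    ⟪tensorVec f g, tensorVec f' g'⟫_ℂ = ⟪f, f'⟫_ℂ * ⟪g, g'⟫_ℂ := by
  rw [L2.inner_def, L2.inner_def, L2.inner_def, ← integral_prod_mul]
  refine integral_congr_ae ?_
  filter_upwards [tensorVec_coeFn ν f g, tensorVec_coeFn ν f' g'] with p h1 h2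
  rw [h1, h2]
  simp only [RCLike.inner_apply, map_mul]
  ring

/-- The isometry of the algebraic tensor product `L²(ν) ⊗ L²(ν)` into `L²(ν × ν)` given by
`f ⊗ g ↦ ((s, t) ↦ f(s) g(t))`. Its range is dense, which identifies the Hilbert space tensor
product with `L²(ν × ν)`. -/
def tensorIsometry : (Lp ℂ 2 ν ⊗[ℂ] Lp ℂ 2 ν) →ₗᵢ[ℂ] Lp ℂ 2 (ν.prod ν) :=
  LinearMap.isometryOfInner
    (TensorProduct.lift (LinearMap.mk₂ ℂ (fun f g => tensorVec f g)
      (fun f f' g => by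
        ext1
        filter_upwards [tensorVec_coeFn ν (f + f') g, tensorVec_coeFn ν f g,
          tensorVec_coeFn ν f' g, Lp.coeFn_add (tensorVec f g) (tensorVec f' g),
          quasiMeasurePreserving_fst.ae (Lp.coeFn_add f f')] with p h1 h2 h3 h4 h5
        rw [h1, h4, Pi.add_apply, h2, h3, h5, Pi.add_apply, add_mul])
      (fun c f g => by
        ext1
        filter_upwards [tensorVec_coeFn ν (c • f) g, tensorVec_coeFn ν f g,
          Lp.coeFn_smul c (tensorVec f g),
          quasiMeasurePreserving_fst.ae (Lp.coeFn_smul c f)] with p h1 h2 h4 h5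
        rw [h1, h4, Pi.smul_apply, h2, h5, Pi.smul_apply, smul_mul_assoc])
      (fun f g g' => by
        ext1
        filter_upwards [tensorVec_coeFn ν f (g + g'), tensorVec_coeFn ν f g,
          tensorVec_coeFn ν f g', Lp.coeFn_add (tensorVec f g) (tensorVec f g'),
          quasiMeasurePreserving_snd.ae (Lp.coeFn_add g g')] with p h1 h2 h3 h4 h5
        rw [h1, h4, Pi.add_apply, h2, h3, h5, Pi.add_apply, mul_add])
      (fun c f g => by
        ext1
        filter_upwards [tensorVec_coeFn ν f (c • g), tensorVec_coeFn ν f g,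
          Lp.coeFn_smul c (tensorVec f g),
          quasiMeasurePreserving_snd.ae (Lp.coeFn_smul c g)] with p h1 h2 h4 h5
        rw [h1, h4, Pi.smul_apply, h2, h5, Pi.smul_apply, mul_smul_comm])))
    (fun x y => by
      induction x using TensorProduct.induction_on with
      | zero => simp
      | add x x' hx hx' => rw [map_add, inner_add_left, inner_add_left, hx, hx']
      | tmul f g =>
        induction y using TensorProduct.induction_on with
        | zero => simp
        | add y y' hy hy' => rw [map_add, inner_add_right, inner_add_right, hy, hy']
        | tmul f' g' => simp [inner_tensorVec])

theorem tensorIsometry_tmul (f g : Lp ℂ 2 ν) :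
    tensorIsometry ν (f ⊗ₜ g) = tensorVec f g := by
  simp [tensorIsometry]

theorem denseRange_tensorIsometry : DenseRange (tensorIsometry ν) := by
  have key : ∀ h : Lp ℂ 2 (ν.prod ν), (∀ f g, ⟪tensorVec f g, h⟫_ℂ = 0) → h = 0 := by
    intro h hh
    have hrect : ∀ A B, MeasurableSet A → MeasurableSet B → ν A ≠ ∞ → ν B ≠ ∞ →
        ∫ p in A ×ˢ B, h p ∂(ν.prod ν) = 0 := by
      intro A B hA hB hA' hB'
      have := hh (indicatorConstLp 2 hA hA' 1) (indicatorConstLp 2 hB hB' 1)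
      rw [L2.inner_def] at this
      rw [← integral_indicator (hA.prod hB), ← this]
      refine integral_congr_ae ?_
      filter_upwards [tensorVec_coeFn ν (indicatorConstLp 2 hA hA' (1:ℂ))
        (indicatorConstLp 2 hB hB' 1), quasiMeasurePreserving_fst.ae
        (indicatorConstLp_coeFn (p := 2) (hs := hA) (hμs := hA') (c := (1:ℂ))),
        quasiMeasurePreserving_snd.ae
        (indicatorConstLp_coeFn (p := 2) (hs := hB) (hμs := hB') (c := (1:ℂ)))] with p h1 h2 h3
      rw [h1, h2, h3]
      by_cases h4 : p.1 ∈ A <;> by_cases h5 : p.2 ∈ B <;>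
        simp [Set.indicator, h4, h5]
    have hint : ∀ n, IntegrableOn h (spanningSets ν n ×ˢ spanningSets ν n) (ν.prod ν) := by
      intro n
      have hlt : (ν.prod ν) (spanningSets ν n ×ˢ spanningSets ν n) < ∞ := by
        rw [prod_prod]
        exact ENNReal.mul_lt_top (measure_spanningSets_lt_top ν n) (measure_spanningSets_lt_top ν n)
      have : IsFiniteMeasure ((ν.prod ν).restrict (spanningSets ν n ×ˢ spanningSets ν n)) :=
        ⟨by simpa using hlt⟩
      exact ((Lp.memLp h).restrict _).integrable (by norm_num)
    have hall : ∀ n, ∀ E : Set (X × X), MeasurableSet E →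
        ∫ p in E ∩ (spanningSets ν n ×ˢ spanningSets ν n), h p ∂(ν.prod ν) = 0 := by
      intro n E hE
      have hS := (measurableSet_spanningSets ν n).prod (measurableSet_spanningSets ν n)
      induction E, hE using MeasurableSpace.induction_on_inter generateFrom_prod.symm
        isPiSystem_prod with
      | empty => simp
      | basic t ht =>
        obtain ⟨A, hA, B, hB, rfl⟩ := ht
        rw [Set.prod_inter_prod]
        have hf := (measure_spanningSets_lt_top ν n)
        exact hrect _ _ (hA.inter (measurableSet_spanningSets ν n))
          (hB.inter (measurableSet_spanningSets ν n))
          (measure_inter_lt_top_of_right_ne_top hf.ne).ne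
          (measure_inter_lt_top_of_right_ne_top hf.ne).ne
      | compl t ht ih =>
        have h1 := setIntegral_union (f := h) (μ := ν.prod ν)
          (s := t ∩ (spanningSets ν n ×ˢ spanningSets ν n))
          (t := tᶜ ∩ (spanningSets ν n ×ˢ spanningSets ν n))
          (by
            refine Set.disjoint_left.2 ?_
            rintro x ⟨hx, -⟩ ⟨hx', -⟩
            exact hx' hx) (ht.compl.inter hS)
          ((hint n).mono_set Set.inter_subset_right) ((hint n).mono_set Set.inter_subset_right)
        rw [← Set.union_inter_distrib_right, Set.union_compl_self, Set.univ_inter, ih, zero_add,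
          hrect _ _ (measurableSet_spanningSets ν n) (measurableSet_spanningSets ν n)
          (measure_spanningSets_lt_top ν n).ne (measure_spanningSets_lt_top ν n).ne] at h1
        exact h1.symm
      | iUnion f hd hf ih =>
        rw [Set.iUnion_inter, integral_iUnion (fun i => (hf i).inter hS) ?_ ?_]
        · simp [ih]
        · intro i j hij
          exact (hd hij).mono Set.inter_subset_left Set.inter_subset_left
        · rw [← Set.iUnion_inter]
          exact (hint n).mono_set Set.inter_subset_right
    have hz : ∀ n, h =ᵐ[(ν.prod ν).restrict (spanningSets ν n ×ˢ spanningSets ν n)] 0 := by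
      intro n
      refine Integrable.ae_eq_zero_of_forall_setIntegral_eq_zero (hint n) ?_
      intro s hs _
      rw [Measure.restrict_restrict hs]
      exact hall n s hs
    have hU : (⋃ n, spanningSets ν n ×ˢ spanningSets ν n) = Set.univ := by
      rw [Set.iUnion_prod_of_monotone (monotone_spanningSets ν) (monotone_spanningSets ν),
        iUnion_spanningSets, Set.univ_prod_univ]
    have : h =ᵐ[ν.prod ν] 0 := by
      have := (ae_restrict_iUnion_iff (μ := ν.prod ν)
        (fun n => spanningSets ν n ×ˢ spanningSets ν n) (fun p => h p = 0)).2 hz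
      rwa [hU, Measure.restrict_univ] at this
    exact (Lp.eq_zero_iff_ae_eq_zero).2 this
  have : (LinearMap.range (tensorIsometry ν).toLinearMap).topologicalClosure = ⊤ := by
    rw [Submodule.topologicalClosure_eq_top_iff, Submodule.eq_bot_iff]
    intro h hh
    refine key h fun f g => ?_
    exact (Submodule.mem_orthogonal _ _).1 hh _ ⟨f ⊗ₜ g, tensorIsometry_tmul ν f g⟩
  intro x
  have hx : x ∈ (LinearMap.range (tensorIsometry ν).toLinearMap).topologicalClosure := by
    rw [this]; trivial
  simpa using! hx

/-- The operator `T ⊗ I` on `L²(ν × ν) = L²(ν) ⊗ L²(ν)`: the continuous extension of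
`f ⊗ g ↦ T f ⊗ g`. -/
def ampliation {X : Type*} [MeasurableSpace X] {ν : Measure X} [SigmaFinite ν] (T : Lp ℂ 2 ν →L[ℂ] Lp ℂ 2 ν) : Lp ℂ 2 (ν.prod ν) →L[ℂ] Lp ℂ 2 (ν.prod ν) :=
  ((tensorIsometry ν).toContinuousLinearMap ∘L T.rTensor (Lp ℂ 2 ν)).extend
    (tensorIsometry ν).toContinuousLinearMap

theorem ampliation_tensorVec (T : Lp ℂ 2 ν →L[ℂ] Lp ℂ 2 ν) (f g : Lp ℂ 2 ν) :
    ampliation T (tensorVec f g) = tensorVec (T f) g := by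
  have := ContinuousLinearMap.extend_eq
    ((tensorIsometry ν).toContinuousLinearMap ∘L T.rTensor (Lp ℂ 2 ν))
    (e := (tensorIsometry ν).toContinuousLinearMap) (denseRange_tensorIsometry ν)
    (tensorIsometry ν).isometry.isUniformInducing (f ⊗ₜ g)
  simpa [ampliation, tensorIsometry_tmul] using this

end Tensor

section Group

variable {G : Type*} [Group G] [TopologicalSpace G] [IsTopologicalGroup G] [LocallyCompactSpace G]

/-- The modular function `Δ`, normalised so that `Δ(t) ∫ f(st) ds = ∫ f(s) ds` for left Haar measure
`ds`. (Mathlib's `modularCharacter` is the reciprocal of it.) -/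
def modularFn (t : G) : ℝ≥0 := modularCharacter t⁻¹

theorem modularFn_pos (t : G) : 0 < modularFn t := modularCharacterFun_pos _

variable [SecondCountableTopology G] [MeasurableSpace G] [BorelSpace G]
variable (m : Measure G) [IsHaarMeasure m]

theorem modularFn_smul_map (r : G) : modularFn r • map (· * r) m = m := by
  have h : map (· * r) m = modularCharacterFun r • m := by
    rw [modularCharacterFun_eq_haarScalarFactor m]
    have : IsHaarMeasure (map (· * r) m) := inferInstance
    exact isMulLeftInvariant_eq_smul _ m
  have h1 : modularFn r * modularCharacterFun r = 1 := by
    have := map_mul (modularCharacter (G := G)) r⁻¹ r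
    rw [inv_mul_cancel, map_one] at this
    exact this.symm
  rw [h, smul_smul, h1, one_smul]

theorem lintegral_mul_right_modularFn (r : G) (f : G → ℝ≥0∞) (hf : Measurable f) :
    (modularFn r : ℝ≥0∞) * ∫⁻ s, f (s * r) ∂m = ∫⁻ s, f s ∂m := by
  conv_rhs => rw [← modularFn_smul_map m r]
  rw [lintegral_smul_measure, lintegral_map hf (measurable_mul_const r)]
  rfl

theorem measurable_modularFn : Measurable (modularFn : G → ℝ≥0) := by
  obtain ⟨⟨f, f_cont⟩, f_comp, f_nonneg, f_one⟩ :
    ∃ f : C(G, ℝ), HasCompactSupport f ∧ 0 ≤ f ∧ f 1 ≠ 0 := exists_continuous_nonneg_pos 1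
  let ν : Measure G := haar
  have hpos := f_cont.integral_pos_of_hasCompactSupport_nonneg_nonzero (μ := ν) f_comp f_nonneg f_one
  have key : ∀ t : G, (modularFn t : ℝ) = (∫ s, f (s * t⁻¹) ∂ν) / ∫ s, f s ∂ν := by
    intro t
    have h := modularFn_smul_map ν t⁻¹
    have h1 : (modularFn t⁻¹ : ℝ) * ∫ s, f (s * t⁻¹) ∂ν = ∫ s, f s ∂ν := by
      conv_rhs => rw [← h]
      rw [integral_smul_nnreal_measure, integral_map (measurable_mul_const _).aemeasurable
        f_cont.aestronglyMeasurable]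
      rfl
    have h2 : (modularFn t : ℝ) * modularFn t⁻¹ = 1 := by
      have := map_mul (modularCharacter (G := G)) t⁻¹ t
      rw [inv_mul_cancel, map_one] at this
      have h3 : modularFn t * modularFn t⁻¹ = 1 := by
        simpa [modularFn] using this.symm
      exact_mod_cast h3
    rw [eq_div_iff hpos.ne', ← h1, ← mul_assoc, h2, one_mul]
  have hm : Measurable fun t : G => (modularFn t : ℝ) := by
    simp_rw [key]
    refine Measurable.div_const ?_ _
    have : StronglyMeasurable (Function.uncurry fun (t s : G) => f (s * t⁻¹)) :=
      (by fun_prop : Continuous (Function.uncurry fun (t s : G) => f (s * t⁻¹))).stronglyMeasurable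
    exact this.integral_prod_right.measurable
  simpa using hm.real_toNNReal

theorem coe_sqrt_sq (c : ℝ≥0) : ((NNReal.sqrt c : ℝ≥0) : ℝ≥0∞) ^ 2 = c := by
  rw [← ENNReal.coe_pow, NNReal.sq_sqrt]

/-- The left regular representation, `(λ_s f)(t) = f(s⁻¹ t)`. -/
def leftReg (s : G) : Lp ℂ 2 m →L[ℂ] Lp ℂ 2 m :=
  (Lp.compMeasurePreservingₗᵢ ℂ (fun t => s⁻¹ * t)
    (measurePreserving_mul_left m s⁻¹)).toContinuousLinearMap

theorem leftReg_coeFn (s : G) (f : Lp ℂ 2 m) : leftReg m s f =ᵐ[m] fun t => f (s⁻¹ * t) :=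
  Lp.coeFn_compMeasurePreserving f (measurePreserving_mul_left m s⁻¹)

/-- The right regular representation, `(ρ_r f)(s) = Δ(r)^{1/2} f(sr)`. -/
def rightReg (r : G) : Lp ℂ 2 m →L[ℂ] Lp ℂ 2 m :=
  weightedComp (fun s => s * r) (fun _ => NNReal.sqrt (modularFn r))
    (quasiMeasurePreserving_mul_right m r) measurable_const (by
      simp_rw [coe_sqrt_sq]
      rw [withDensity_const, Measure.map_smul]
      exact modularFn_smul_map m r)

theorem rightReg_coeFn (r : G) (f : Lp ℂ 2 m) :
    rightReg m r f =ᵐ[m] fun s => ((NNReal.sqrt (modularFn r) : ℝ) : ℂ) * f (s * r) :=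
  weightedComp_coeFn _ _ _ f

theorem rightReg_norm (r : G) (f : Lp ℂ 2 m) : ‖rightReg m r f‖ = ‖f‖ :=
  weightedComp_norm _ _ _ f

theorem quasiMeasurePreserving_fundamental :
    QuasiMeasurePreserving (fun p : G × G => (p.1 * p.2, p.2)) (m.prod m) (m.prod m) := by
  have hmeas : Measurable fun p : G × G => (p.1 * p.2, p.2) := by fun_prop
  refine ⟨hmeas, AbsolutelyContinuous.mk fun s hs h => ?_⟩
  rw [map_apply hmeas hs, prod_apply_symm (hmeas hs), lintegral_eq_zero_iff
    (measurable_measure_prodMk_right (hmeas hs))]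
  rw [prod_apply_symm hs, lintegral_eq_zero_iff (measurable_measure_prodMk_right hs)] at h
  filter_upwards [h] with t ht
  exact (quasiMeasurePreserving_mul_right m t).preimage_null ht

theorem map_fundamental :
    map (fun p : G × G => (p.1 * p.2, p.2))
      ((m.prod m).withDensity fun p => ((NNReal.sqrt (modularFn p.2) : ℝ≥0) : ℝ≥0∞) ^ 2) =
      m.prod m := by
  have hmeas : Measurable fun p : G × G => (p.1 * p.2, p.2) := by fun_prop
  simp_rw [coe_sqrt_sq]
  have hΔ : Measurable fun p : G × G => (modularFn p.2 : ℝ≥0∞) :=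
    (measurable_modularFn.comp measurable_snd).coe_nnreal_ennreal
  refine Measure.ext_of_lintegral _ fun f hf => ?_
  have hf' : Measurable fun p : G × G => f (p.1 * p.2, p.2) := hf.comp hmeas
  rw [lintegral_map hf hmeas, lintegral_withDensity_eq_lintegral_mul _ hΔ hf',
    lintegral_prod_symm' _ (hΔ.mul hf'), lintegral_prod_symm' _ hf]
  refine lintegral_congr fun t => ?_
  simp only [Pi.mul_apply]
  rw [lintegral_const_mul (modularFn t : ℝ≥0∞) (f := fun s => f (s * t, t))
    (hf.comp (hmeas.comp measurable_prodMk_right))]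
  exact lintegral_mul_right_modularFn m t (fun s => f (s, t)) (hf.comp measurable_prodMk_right)

/-- The fundamental unitary, `(V ξ)(s, t) = ξ(st, t) Δ(t)^{1/2}`. -/
def fundamentalUnitary : Lp ℂ 2 (m.prod m) →L[ℂ] Lp ℂ 2 (m.prod m) :=
  weightedComp (fun p => (p.1 * p.2, p.2)) (fun p => NNReal.sqrt (modularFn p.2))
    (quasiMeasurePreserving_fundamental m)
    (NNReal.continuous_sqrt.measurable.comp (measurable_modularFn.comp measurable_snd))
    (map_fundamental m)

theorem fundamentalUnitary_norm (ξ : Lp ℂ 2 (m.prod m)) : ‖fundamentalUnitary m ξ‖ = ‖ξ‖ :=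
  weightedComp_norm _ _ _ ξ

theorem fundamentalUnitary_coeFn (ξ : Lp ℂ 2 (m.prod m)) :
    fundamentalUnitary m ξ =ᵐ[m.prod m]
      fun p => ((NNReal.sqrt (modularFn p.2) : ℝ) : ℂ) * ξ (p.1 * p.2, p.2) :=
  weightedComp_coeFn _ _ _ ξ

/-- `Γ̃(T) = V (T ⊗ I) V^*`. -/
def gammaTilde (T : Lp ℂ 2 m →L[ℂ] Lp ℂ 2 m) : Lp ℂ 2 (m.prod m) →L[ℂ] Lp ℂ 2 (m.prod m) :=
  fundamentalUnitary m ∘L ampliation T ∘L ContinuousLinearMap.adjoint (fundamentalUnitary m)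

/-- The group von Neumann algebra `VN(G)`: the weak-* closed linear span of the `λ_s`. -/
def groupVN : Set (Lp ℂ 2 m →L[ℂ] Lp ℂ 2 m) := weakStarSpan (Set.range (leftReg m))

/-- The weak-* closed `VN(G)`-bimodule generated by the multiplication operators with symbol in `U`. -/
def bimodule (U : Set (Lp ℂ ∞ m)) : Set (Lp ℂ 2 m →L[ℂ] Lp ℂ 2 m) :=
  weakStarSpan {T | ∃ A ∈ groupVN m, ∃ B ∈ groupVN m, ∃ a ∈ U, T = A ∘L mulOp a ∘L B}

section Poisson

variable (μ : Measure G) [IsProbabilityMeasure μ]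

theorem quasiMeasurePreserving_mul_prod :
    QuasiMeasurePreserving (fun p : G × G => p.1 * p.2) (m.prod μ) m :=
  QuasiMeasurePreserving.prod_of_left measurable_mul
    (Eventually.of_forall fun t => quasiMeasurePreserving_mul_right m t)

variable {m} in
theorem ae_norm_le (φ : Lp ℂ ∞ m) : ∀ᵐ x ∂m, ‖φ x‖ ≤ ‖φ‖ := by
  have := ae_le_eLpNormEssSup (f := φ) (μ := m)
  filter_upwards [this] with x hx
  rw [Lp.norm_def, eLpNorm_exponent_top, ← toReal_enorm]
  refine ENNReal.toReal_mono ?_ hx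
  rw [← eLpNorm_exponent_top]
  exact (Lp.memLp φ).2.ne

theorem memLp_poisson (φ : Lp ℂ ∞ m) : MemLp (fun s => ∫ t, φ (s * t) ∂μ) ∞ m := by
  have hq := quasiMeasurePreserving_mul_prod m μ
  refine memLp_top_of_bound
    ((Lp.memLp φ).1.comp_quasiMeasurePreserving hq).integral_prod_right' ‖φ‖ ?_
  filter_upwards [ae_ae_of_ae_prod (hq.ae (ae_norm_le φ))] with s hs
  simpa using norm_integral_le_of_norm_le_const hs

/-- `(P_μ φ)(s) = ∫ φ(st) dμ(t)` as an element of `L^∞(G)`. -/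
def poissonOp (φ : Lp ℂ ∞ m) : Lp ℂ ∞ m := (memLp_poisson m μ φ).toLp

theorem poissonOp_coeFn (φ : Lp ℂ ∞ m) :
    poissonOp m μ φ =ᵐ[m] fun s => ∫ t, φ (s * t) ∂μ :=
  MemLp.coeFn_toLp (memLp_poisson m μ φ)

/-- The space `H(μ)` of `μ`-harmonic functions in `L^∞(G)`. -/
def harmonicFunctions : Set (Lp ℂ ∞ m) := {φ | poissonOp m μ φ = φ}

end Poisson

section Theta

theorem stronglyMeasurable_rightReg (f : Lp ℂ 2 m) :
    StronglyMeasurable fun r => rightReg m r f := by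
  have : Fact ((2 : ℝ≥0∞) ≠ ∞) := ⟨by simp⟩
  borelize (↥(Lp ℂ 2 m))
  have hin : ∀ g : Lp ℂ 2 m, Measurable fun r => RCLike.re ⟪g, rightReg m r f⟫_ℂ := by
    intro g
    have h1 : ∀ r, ⟪g, rightReg m r f⟫_ℂ =
        ∫ s, (((NNReal.sqrt (modularFn r) : ℝ) : ℂ) * f (s * r)) * (starRingEnd ℂ) (g s) ∂m := by
      intro r
      rw [L2.inner_def]
      refine integral_congr_ae ?_
      filter_upwards [rightReg_coeFn m r f] with s hs
      rw [hs, RCLike.inner_apply]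
    simp_rw [h1]
    refine Measurable.comp (by fun_prop) (StronglyMeasurable.measurable ?_)
    refine StronglyMeasurable.integral_prod_right (f := fun r s =>
      (((NNReal.sqrt (modularFn r) : ℝ) : ℂ) * f (s * r)) * (starRingEnd ℂ) (g s)) ?_
    have hs : Measurable fun r : G => NNReal.sqrt (modularFn r) :=
      NNReal.continuous_sqrt.measurable.comp measurable_modularFn
    have hf := (Lp.stronglyMeasurable f).measurable
    have hg := (Lp.stronglyMeasurable g).measurable
    have hc : Measurable (starRingEnd ℂ) := Complex.continuous_conj.measurable
    refine Measurable.stronglyMeasurable ?_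
    refine Measurable.mul (Measurable.mul ?_ (hf.comp (measurable_snd.mul measurable_fst)))
      (hc.comp (hg.comp measurable_snd))
    exact Complex.measurable_ofReal.comp (hs.comp measurable_fst).coe_nnreal_real
  have hball : ∀ (g : Lp ℂ 2 m) (ε : ℝ),
      MeasurableSet ((fun r => rightReg m r f) ⁻¹' Metric.ball g ε) := by
    intro g ε
    have hd : Measurable fun r => dist (rightReg m r f) g := by
      have : ∀ r, dist (rightReg m r f) g =
          √(‖f‖ ^ 2 - 2 * RCLike.re ⟪g, rightReg m r f⟫_ℂ + ‖g‖ ^ 2) := by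
        intro r
        rw [dist_eq_norm, ← rightReg_norm m r f, inner_re_symm, ← norm_sub_sq,
          Real.sqrt_sq (norm_nonneg _)]
      simp_rw [this]
      have := hin g
      fun_prop
    exact measurableSet_lt hd measurable_const
  have hbasis : TopologicalSpace.IsTopologicalBasis
      {U : Set (Lp ℂ 2 m) | ∃ g ε, U = Metric.ball g ε} := by
    refine TopologicalSpace.isTopologicalBasis_of_isOpen_of_nhds ?_ ?_
    · rintro U ⟨g, ε, rfl⟩
      exact Metric.isOpen_ball
    · intro g U hg hU
      obtain ⟨ε, hε, h⟩ := Metric.isOpen_iff.1 hU g hg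
      exact ⟨_, ⟨g, ε, rfl⟩, Metric.mem_ball_self hε, h⟩
  have hmeas : Measurable fun r => rightReg m r f := by
    have hgen := (BorelSpace.measurable_eq (α := Lp ℂ 2 m)).trans hbasis.borel_eq_generateFrom
    rw [hgen]
    refine measurable_generateFrom ?_
    rintro _ ⟨g, ε, rfl⟩
    exact hball g ε
  exact hmeas.stronglyMeasurable

theorem rightReg_inv_cancel (r : G) (f : Lp ℂ 2 m) : rightReg m r (rightReg m r⁻¹ f) = f := by
  ext1
  filter_upwards [rightReg_coeFn m r (rightReg m r⁻¹ f),
    (quasiMeasurePreserving_mul_right m r).ae (rightReg_coeFn m r⁻¹ f)] with s h1 h2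
  have h3 : NNReal.sqrt (modularFn r) * NNReal.sqrt (modularFn r⁻¹) = 1 := by
    have := map_mul (modularCharacter (G := G)) r⁻¹ r
    rw [inv_mul_cancel, map_one] at this
    rw [← NNReal.sqrt_mul, modularFn, modularFn, inv_inv, ← this, NNReal.sqrt_one]
  have h4 : ((NNReal.sqrt (modularFn r) : ℝ) : ℂ) * ((NNReal.sqrt (modularFn r⁻¹) : ℝ) : ℂ) = 1 := by
    exact_mod_cast h3
  rw [h1, h2, ← mul_assoc, h4, one_mul, mul_inv_cancel_right]

theorem adjoint_rightReg (r : G) :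
    ContinuousLinearMap.adjoint (rightReg m r) = rightReg m r⁻¹ := by
  have h1 : ContinuousLinearMap.adjoint (rightReg m r) ∘L rightReg m r = 1 :=
    (ContinuousLinearMap.norm_map_iff_adjoint_comp_self _).1 (rightReg_norm m r)
  ext1 f
  have := DFunLike.congr_fun h1 (rightReg m r⁻¹ f)
  simpa [rightReg_inv_cancel] using this

variable {m} in
/-- The operator `(Ad ρ_r)(T) = ρ_r T ρ_r^*`. -/
def adRho (r : G) (T : Lp ℂ 2 m →L[ℂ] Lp ℂ 2 m) : Lp ℂ 2 m →L[ℂ] Lp ℂ 2 m :=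
  rightReg m r ∘L T ∘L ContinuousLinearMap.adjoint (rightReg m r)

theorem norm_adRho_le (r : G) (T : Lp ℂ 2 m →L[ℂ] Lp ℂ 2 m) (ξ : Lp ℂ 2 m) :
    ‖adRho r T ξ‖ ≤ ‖T‖ * ‖ξ‖ := by
  simp only [adRho, ContinuousLinearMap.comp_apply, adjoint_rightReg, rightReg_norm]
  refine (T.le_opNorm _).trans_eq ?_
  rw [rightReg_norm]

theorem stronglyMeasurable_adRho (T : Lp ℂ 2 m →L[ℂ] Lp ℂ 2 m) (ξ : Lp ℂ 2 m) :
    StronglyMeasurable fun r => adRho r T ξ := by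
  have : Fact ((2 : ℝ≥0∞) ≠ ∞) := ⟨by simp⟩
  borelize (↥(Lp ℂ 2 m))
  have h1 : StronglyMeasurable (Function.uncurry fun (f : Lp ℂ 2 m) (r : G) => rightReg m r f) :=
    stronglyMeasurable_uncurry_of_continuous_of_stronglyMeasurable
      (fun r => (rightReg m r).continuous) (fun f => stronglyMeasurable_rightReg m f)
  have h2 : Measurable fun r : G => T (rightReg m r⁻¹ ξ) :=
    T.continuous.measurable.comp
      ((stronglyMeasurable_rightReg m ξ).measurable.comp measurable_inv)
  have h3 := h1.comp_measurable (h2.prodMk measurable_id)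
  simpa [adRho, adjoint_rightReg, Function.comp_def] using h3

theorem integrable_adRho (μ : Measure G) [IsProbabilityMeasure μ]
    (T : Lp ℂ 2 m →L[ℂ] Lp ℂ 2 m) (ξ : Lp ℂ 2 m) : Integrable (fun r => adRho r T ξ) μ :=
  Integrable.of_bound (stronglyMeasurable_adRho m T ξ).aestronglyMeasurable (‖T‖ * ‖ξ‖)
    (Eventually.of_forall fun r => norm_adRho_le m r T ξ)

/-- The operator `Θ(μ)(T) = ∫ ρ_r T ρ_r^* dμ(r)`, given by `Θ(μ)(T) ξ = ∫ ρ_r T ρ_r^* ξ dμ(r)`.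
By `tracePairing_theta` it satisfies `⟨Θ(μ)(T), h⟩ = ∫ ⟨ρ_r T ρ_r^*, h⟩ dμ(r)` for every trace class
element `h`, which determines it. -/
def theta (μ : Measure G) [IsProbabilityMeasure μ] (T : Lp ℂ 2 m →L[ℂ] Lp ℂ 2 m) :
    Lp ℂ 2 m →L[ℂ] Lp ℂ 2 m :=
  LinearMap.mkContinuous
    { toFun := fun ξ => ∫ r, adRho r T ξ ∂μ
      map_add' := fun ξ η => by
        simp_rw [map_add]
        exact integral_add (integrable_adRho m μ T ξ) (integrable_adRho m μ T η)
      map_smul' := fun c ξ => by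
        simp_rw [map_smul]
        exact integral_smul c _ }
    ‖T‖ fun ξ => by
      simpa using norm_integral_le_of_norm_le_const (μ := μ)
        (Eventually.of_forall fun r => norm_adRho_le m r T ξ)

theorem tracePairing_theta (μ : Measure G) [IsProbabilityMeasure μ]
    (T : Lp ℂ 2 m →L[ℂ] Lp ℂ 2 m) (ξ η : lp (fun _ : ℕ => Lp ℂ 2 m) 2) :
    tracePairing (theta m μ T) ξ η = ∫ r, tracePairing (adRho r T) ξ η ∂μ := by
  have hint : ∀ n, Integrable (fun r => ⟪η n, adRho r T (ξ n)⟫_ℂ) μ := fun n =>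
    (innerSL ℂ (η n)).integrable_comp (integrable_adRho m μ T (ξ n))
  have hsum : Summable fun n => ‖T‖ * (‖η n‖ * ‖ξ n‖) := by
    refine Summable.mul_left _ (lp.summable_mul ?_ η ξ)
    rw [Real.holderConjugate_iff]; norm_num
  have hb : ∀ n r, ‖⟪η n, adRho r T (ξ n)⟫_ℂ‖ ≤ ‖T‖ * (‖η n‖ * ‖ξ n‖) := fun n r => by
    refine (norm_inner_le_norm _ _).trans ?_
    have := mul_le_mul_of_nonneg_left (norm_adRho_le m r T (ξ n)) (norm_nonneg (η n))
    linarith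
  have h := integral_tsum_of_summable_integral_norm (μ := μ) hint
    (hsum.of_nonneg_of_le (fun n => integral_nonneg fun r => norm_nonneg _) fun n => by
      have := integral_mono (μ := μ) (hint n).norm (integrable_const _) (hb n)
      simpa using this)
  unfold tracePairing
  rw [← h]
  refine tsum_congr fun n => ?_
  exact ((innerSL ℂ (η n)).integral_comp_comm (integrable_adRho m μ T (ξ n))).symm

/-- The space `H̃(μ)` of `μ`-harmonic operators on `L²(G)`. -/
def harmonicOperators (μ : Measure G) [IsProbabilityMeasure μ] :
    Set (Lp ℂ 2 m →L[ℂ] Lp ℂ 2 m) :=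
  {T | theta m μ T = T}

end Theta

section Crossed

variable {m} in
/-- The action `α` of `G` on `L^∞(G)` by left translation, `(α_s φ)(t) = φ(s⁻¹ t)`. It maps `H(μ)`
into itself, see `leftTranslate_mem_harmonicFunctions`. -/
def leftTranslate (s : G) (φ : Lp ℂ ∞ m) : Lp ℂ ∞ m :=
  Lp.compMeasurePreserving (fun t => s⁻¹ * t) (measurePreserving_mul_left m s⁻¹) φ

theorem leftTranslate_coeFn (s : G) (φ : Lp ℂ ∞ m) :
    leftTranslate s φ =ᵐ[m] fun t => φ (s⁻¹ * t) :=
  Lp.coeFn_compMeasurePreserving φ (measurePreserving_mul_left m s⁻¹)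

theorem memLp_alphaTilde (φ : Lp ℂ ∞ m) :
    MemLp (fun p : G × G => φ (p.1 * p.2)) ∞ (m.prod m) := by
  have hq := quasiMeasurePreserving_fst.comp (quasiMeasurePreserving_fundamental m)
  exact memLp_top_of_bound ((Lp.memLp φ).1.comp_quasiMeasurePreserving hq) ‖φ‖
    (hq.ae (ae_norm_le φ))

/-- The element `α̃(φ) = (α_s⁻¹ φ)_{s ∈ G}` of `L^∞(G, L^∞(G)) = L^∞(G × G)`, i.e. the function
`(s, t) ↦ (α_s⁻¹ φ)(t) = φ(st)`; see `alphaTilde_slice`. -/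
def alphaTilde (φ : Lp ℂ ∞ m) : Lp ℂ ∞ (m.prod m) := (memLp_alphaTilde m φ).toLp

theorem alphaTilde_coeFn (φ : Lp ℂ ∞ m) :
    alphaTilde m φ =ᵐ[m.prod m] fun p => φ (p.1 * p.2) :=
  MemLp.coeFn_toLp (memLp_alphaTilde m φ)

theorem alphaTilde_slice (φ : Lp ℂ ∞ m) :
    ∀ᵐ s ∂m, (fun t => alphaTilde m φ (s, t)) =ᵐ[m] leftTranslate s⁻¹ φ := by
  filter_upwards [ae_ae_of_ae_prod (alphaTilde_coeFn m φ)] with s hs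
  filter_upwards [hs, leftTranslate_coeFn m s⁻¹ φ] with t h1 h2
  rw [h1, h2, inv_inv]

theorem leftTranslate_mem_harmonicFunctions (μ : Measure G) [IsProbabilityMeasure μ] (s : G)
    {φ : Lp ℂ ∞ m} (hφ : φ ∈ harmonicFunctions m μ) :
    leftTranslate s φ ∈ harmonicFunctions m μ := by
  have hq := quasiMeasurePreserving_mul_prod m μ
  have hs := (measurePreserving_mul_left m s⁻¹).quasiMeasurePreserving
  have h0 : (fun x => ∫ t, φ (x * t) ∂μ) =ᵐ[m] φ := by
    have := poissonOp_coeFn m μ φ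
    rw [show poissonOp m μ φ = φ from hφ] at this
    exact this.symm
  show poissonOp m μ _ = _
  ext1
  filter_upwards [poissonOp_coeFn m μ (leftTranslate s φ), hs.ae h0,
    leftTranslate_coeFn m s φ, ae_ae_of_ae_prod (hq.ae (leftTranslate_coeFn m s φ))]
    with x h1 h2 h3 h4
  rw [h1, h3, ← h2]
  refine integral_congr_ae ?_
  filter_upwards [h4] with t ht
  rw [ht, mul_assoc]

/-- The crossed product `G ⋊_α M` of a left translation invariant space `M ⊆ L^∞(G)` by the action `α`
of left translation: the weak-* closed linear span, on `L²(G) ⊗ L²(G)`, of the operators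
`α̃(v) (λ_s ⊗ I)` with `v ∈ M` and `s ∈ G`. -/
def crossedProduct (M : Set (Lp ℂ ∞ m)) :
    Set (Lp ℂ 2 (m.prod m) →L[ℂ] Lp ℂ 2 (m.prod m)) :=
  weakStarSpan {T | ∃ v ∈ M, ∃ s : G, T = mulOp (alphaTilde m v) ∘L ampliation (leftReg m s)}

end Crossed
end Group
end HarmonicCrossed

end

open HarmonicCrossed

/-! Everything is decided on the operators M_φ λ_s. The covariance relation λ_s M_φ = M_{α_s φ} λ_s
and the left translation invariance of H(μ) show that Bim(H(μ)) is the weak-* closed span of these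
operators (`bimodule_eq_weakStarSpan`). The unitary V commutes with λ_s ⊗ I and intertwines M_φ ⊗ I
with multiplication by φ(st), so Γ̃ sends M_φ λ_s exactly to the generator α̃(φ)(λ_s ⊗ I) of the
crossed product (`gammaTilde_mulOp_comp_leftReg`).

To pass from generators to closed spans, Γ̃ must carry closed sets to closed sets. It is weak-*
continuous and has a weak-* continuous left inverse (conjugate back by V, then slice the second
tensor factor with a unit vector), hence is a closed embedding (`gammaTilde_image_weakStarSpan`).

For the inclusion it is enough that Bim(H(μ)) ⊆ H̃(μ). Since ρ_r commutes with λ_s and Ad ρ_r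
translates φ on the right, Fubini gives Θ(μ)(M_φ λ_s) = M_{P_μ φ} λ_s = M_φ λ_s; and H̃(μ) is a
weak-* closed subspace (`isClosed_harmonicOperators`).

The common analytic input is `continuous_of_tensor`, the weak-* continuity of T ↦ T ⊗ I. It is used
on L²(G × G), for Γ̃, and on L²(μ; L²(G)), where it makes averages over μ weak-* continuous in T. -/

noncomputable section

namespace HarmonicCrossed

open scoped Topology

/-! ### Weak-* continuous functionals and maps, and closed spans -/

section WeakStar

variable {E F K : Type*} [NormedAddCommGroup E] [InnerProductSpace ℂ E]
  [NormedAddCommGroup F] [InnerProductSpace ℂ F] [NormedAddCommGroup K] [InnerProductSpace ℂ K]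

theorem continuous_tracePairing (ξ η : lp (fun _ : ℕ => E) 2) :
    Continuous[weakStarTopology E, inferInstance] fun T => tracePairing T ξ η :=
  @Continuous.comp _ _ _ (weakStarTopology E) _ _ _
    (fun u : lp (fun _ : ℕ => E) 2 × lp (fun _ : ℕ => E) 2 → ℂ => u (ξ, η))
    (continuous_apply (ξ, η)) continuous_induced_dom

theorem continuous_weakStar_iff {Y : Type*} {tY : TopologicalSpace Y} {f : Y → E →L[ℂ] E} :
    Continuous[tY, weakStarTopology E] f ↔
      ∀ ξ η : lp (fun _ : ℕ => E) 2, Continuous fun y => tracePairing (f y) ξ η := by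
  rw [continuous_induced_rng, continuous_pi_iff, Prod.forall]
  rfl

omit [InnerProductSpace ℂ E] in
theorem memℓp_two_iff_summable_sq {ι : Type*} {a : ι → E} :
    Memℓp a 2 ↔ Summable fun i => ‖a i‖ ^ 2 := by
  rw [memℓp_gen_iff (by simp)]
  simp

omit [InnerProductSpace ℂ E] in
theorem summable_sq_lp {ι : Type*} (a : lp (fun _ : ι => E) 2) : Summable fun i => ‖a i‖ ^ 2 :=
  memℓp_two_iff_summable_sq.1 (lp.memℓp a)

/-- Square summable families of any index set define weak-* continuous functionals. -/
theorem continuous_tsum_inner {ι : Type*} {a b : ι → E} (ha : Summable fun i => ‖a i‖ ^ 2)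
    (hb : Summable fun i => ‖b i‖ ^ 2) :
    Continuous[weakStarTopology E, inferInstance] fun T : E →L[ℂ] E =>
      ∑' i, ⟪b i, T (a i)⟫_ℂ := by
  -- A summable family has countable support, so the sum can be reindexed by ℕ and extended by zero.
  -- Arbitrary index sets are needed because the Hilbert bases used later may be uncountable.
  set S := Function.support fun i => ‖a i‖ ^ 2 with hS
  have : Countable S := ha.countable_support.to_subtype
  obtain ⟨f, hf⟩ := exists_injective_nat S
  have hmem : ∀ c : ι → E, (Summable fun i => ‖c i‖ ^ 2) →
      Memℓp (Function.extend f (fun i : S => c i) 0) 2 := by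
    intro c hc
    rw [memℓp_two_iff_summable_sq]
    have h1 : Summable fun i : S => ‖c i‖ ^ 2 := hc.subtype S
    rw [← summable_extend_zero hf] at h1
    refine h1.congr fun n => ?_
    by_cases hn : ∃ i, f i = n
    · obtain ⟨i, rfl⟩ := hn
      simp [hf.extend_apply]
    · simp [Function.extend_apply' _ _ _ hn]
  convert continuous_tracePairing ⟨_, hmem a ha⟩ ⟨_, hmem b hb⟩ using 2 with T
  have h1 : ∑' i : S, ⟪b i, T (a i)⟫_ℂ = ∑' i, ⟪b i, T (a i)⟫_ℂ := by
    refine tsum_subtype_eq_of_support_subset (f := fun i => ⟪b i, T (a i)⟫_ℂ) fun i hi => ?_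
    rw [hS, Function.mem_support]
    intro h
    have h0 : a i = 0 := by simpa using h
    exact hi (by simp [h0])
  rw [← h1, ← tsum_extend_zero hf, tracePairing]
  refine tsum_congr fun n => ?_
  by_cases hn : ∃ i, f i = n
  · obtain ⟨i, rfl⟩ := hn
    simp [hf.extend_apply]
  · simp [Function.extend_apply' _ _ _ hn]

theorem continuous_inner_apply (ξ η : E) :
    Continuous[weakStarTopology E, inferInstance] fun T : E →L[ℂ] E => ⟪η, T ξ⟫_ℂ := by
  have h (x : E) : Summable fun _ : Unit => ‖x‖ ^ 2 := (hasSum_fintype _).summable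
  have := continuous_tsum_inner (h ξ) (h η)
  simpa only [tsum_fintype, Finset.univ_unique, Finset.sum_singleton] using this

theorem t2Space_weakStar : @T2Space (E →L[ℂ] E) (weakStarTopology E) := by
  let := weakStarTopology E
  refine ⟨fun S T hST => ?_⟩
  have : ∃ ξ η : E, ⟪η, S ξ⟫_ℂ ≠ ⟪η, T ξ⟫_ℂ := by
    by_contra! h
    exact hST (ContinuousLinearMap.ext fun ξ => ext_inner_left ℂ fun η => h ξ η)
  obtain ⟨ξ, η, h⟩ := this
  exact separated_by_continuous (continuous_inner_apply ξ η) h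

theorem tracePairing_add (S T : E →L[ℂ] E) (ξ η : lp (fun _ : ℕ => E) 2) :
    tracePairing (S + T) ξ η = tracePairing S ξ η + tracePairing T ξ η := by
  simp only [tracePairing, _root_.add_apply, inner_add_right]
  exact (summable_tracePairing S ξ η).tsum_add (summable_tracePairing T ξ η)

theorem tracePairing_smul (c : ℂ) (T : E →L[ℂ] E) (ξ η : lp (fun _ : ℕ => E) 2) :
    tracePairing (c • T) ξ η = c * tracePairing T ξ η := by
  simp only [tracePairing, _root_.smul_apply, inner_smul_right]
  exact tsum_mul_left

theorem continuousAdd_weakStar : @ContinuousAdd (E →L[ℂ] E) (weakStarTopology E) _ := by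
  let := weakStarTopology E
  refine ⟨continuous_weakStar_iff.2 fun ξ η => ?_⟩
  simp_rw [tracePairing_add]
  exact ((continuous_tracePairing ξ η).comp continuous_fst).add
    ((continuous_tracePairing ξ η).comp continuous_snd)

theorem continuousConstSMul_weakStar :
    @ContinuousConstSMul ℂ (E →L[ℂ] E) (weakStarTopology E) _ := by
  let := weakStarTopology E
  refine ⟨fun c => continuous_weakStar_iff.2 fun ξ η => ?_⟩
  simp_rw [tracePairing_smul]
  exact (continuous_tracePairing ξ η).const_mul c

/-- The weak-* closed linear span as a submodule. -/
def weakStarSpanSubmodule (S : Set (E →L[ℂ] E)) : Submodule ℂ (E →L[ℂ] E) :=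
  letI := weakStarTopology E
  haveI := continuousAdd_weakStar (E := E)
  haveI := continuousConstSMul_weakStar (E := E)
  (Submodule.span ℂ S).topologicalClosure

theorem subset_weakStarSpan (S : Set (E →L[ℂ] E)) : S ⊆ weakStarSpan S :=
  Submodule.subset_span.trans (@subset_closure _ (weakStarTopology E) _)

theorem isClosed_weakStarSpan (S : Set (E →L[ℂ] E)) :
    IsClosed[weakStarTopology E] (weakStarSpan S) :=
  @isClosed_closure _ (weakStarTopology E) _

theorem weakStarSpan_subset {S : Set (E →L[ℂ] E)} {W : Submodule ℂ (E →L[ℂ] E)} (h : S ⊆ W)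
    (hW : IsClosed[weakStarTopology E] (W : Set (E →L[ℂ] E))) : weakStarSpan S ⊆ W :=
  @closure_minimal _ (weakStarTopology E) _ _ (Submodule.span_le.2 h) hW

/-- A weak-* continuous linear map with generators mapped into `weakStarSpan S'`. -/
theorem map_weakStarSpan_subset {S : Set (E →L[ℂ] E)} {S' : Set (F →L[ℂ] F)}
    (Φ : (E →L[ℂ] E) →ₗ[ℂ] (F →L[ℂ] F))
    (hΦ : Continuous[weakStarTopology E, weakStarTopology F] Φ)
    (h : ∀ T ∈ S, Φ T ∈ weakStarSpan S') {T : E →L[ℂ] E} (hT : T ∈ weakStarSpan S) :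
    Φ T ∈ weakStarSpan S' := by
  have := weakStarSpan_subset (W := (weakStarSpanSubmodule S').comap Φ) h
    (@IsClosed.preimage _ _ (weakStarTopology E) (weakStarTopology F) _ hΦ _
      (isClosed_weakStarSpan S'))
  exact this hT

/-- A weak-* continuous linear map with a weak-* continuous left inverse preserves weak-* closed
spans. -/
theorem image_weakStarSpan (Φ : (E →L[ℂ] E) →ₗ[ℂ] (F →L[ℂ] F))
    (hΦ : Continuous[weakStarTopology E, weakStarTopology F] Φ)
    (Ψ : (F →L[ℂ] F) → (E →L[ℂ] E))
    (hΨ : Continuous[weakStarTopology F, weakStarTopology E] Ψ)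
    (hinv : Function.LeftInverse Ψ Φ) (S : Set (E →L[ℂ] E)) :
    Φ '' weakStarSpan S = weakStarSpan (Φ '' S) := by
  let := weakStarTopology E
  let := weakStarTopology F
  have : T2Space (F →L[ℂ] F) := t2Space_weakStar
  have hemb : Topology.IsClosedEmbedding Φ := by
    refine ⟨⟨hinv.isEmbedding hΨ hΦ |>.1, hinv.injective⟩, ?_⟩
    -- The range is the fixed point set of the continuous map Φ ∘ Ψ, hence closed in a Hausdorff
    -- space.
    have : Set.range Φ = {y | Φ (Ψ y) = y} := by
      ext y
      refine ⟨?_, fun h => ⟨_, h⟩⟩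
      rintro ⟨x, rfl⟩
      exact congrArg Φ (hinv x)
    rw [this]
    exact isClosed_eq (hΦ.comp hΨ) continuous_id
  rw [weakStarSpan, weakStarSpan, weakStarClosure, weakStarClosure, ← Submodule.map_span,
    Submodule.map_coe]
  exact (hemb.closure_image_eq _).symm

theorem summable_sq_clm_apply {ι : Type*} (T : E →L[ℂ] F) {a : ι → E}
    (ha : Summable fun i => ‖a i‖ ^ 2) : Summable fun i => ‖T (a i)‖ ^ 2 := by
  refine (ha.mul_left (‖T‖ ^ 2)).of_nonneg_of_le (fun n => by positivity) fun n => ?_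
  rw [← mul_pow]
  gcongr
  exact T.le_opNorm _

/-- Moving C to the other side, the pairing of C T D with (ξ, η) is the pairing of T with (D ξₙ) and
(C* ηₙ), which are again square summable. -/
theorem continuous_compress [CompleteSpace E] [CompleteSpace F] (C : E →L[ℂ] F) (D : F →L[ℂ] E) :
    Continuous[weakStarTopology E, weakStarTopology F] fun T : E →L[ℂ] E => C ∘L T ∘L D := by
  refine continuous_weakStar_iff.2 fun ξ η => ?_
  convert continuous_tsum_inner (summable_sq_clm_apply D (summable_sq_lp ξ))
    (summable_sq_clm_apply (ContinuousLinearMap.adjoint C) (summable_sq_lp η)) using 2 with T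
  simp [tracePairing, ContinuousLinearMap.adjoint_inner_left]

theorem summable_inner_of_summable_sq {ι : Type*} {a b : ι → E}
    (ha : Summable fun i => ‖a i‖ ^ 2) (hb : Summable fun i => ‖b i‖ ^ 2) :
    Summable fun i => ⟪b i, a i⟫_ℂ := by
  refine (hb.add ha).of_norm_bounded fun i => (norm_inner_le_norm _ _).trans ?_
  nlinarith [two_mul_le_add_sq ‖b i‖ ‖a i‖, mul_nonneg (norm_nonneg (b i)) (norm_nonneg (a i))]

/-- In Hilbert sum coordinates S is T acting diagonally: S may be applied termwise to the convergent
expansion x = ∑ V i (w i), and the result is the expansion with coordinates T (w i). -/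
theorem linearIsometryEquiv_amplification [CompleteSpace K] {ι : Type*} {V : ι → E →ₗᵢ[ℂ] K}
    (hV : IsHilbertSum ℂ (fun _ : ι => E) V) (T : E →L[ℂ] E) (S : K →L[ℂ] K)
    (hS : ∀ i x, S (V i x) = V i (T x)) (x : K) (i : ι) :
    hV.linearIsometryEquiv (S x) i = T (hV.linearIsometryEquiv x i) := by
  obtain ⟨w, rfl⟩ := hV.linearIsometryEquiv.symm.surjective x
  let w' : lp (fun _ : ι => E) 2 :=
    ⟨fun i => T (w i), memℓp_two_iff_summable_sq.2 (summable_sq_clm_apply T (summable_sq_lp w))⟩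
  have h1 := (hV.hasSum_linearIsometryEquiv_symm w).mapL S
  simp only [hS] at h1
  rw [h1.unique (hV.hasSum_linearIsometryEquiv_symm w'), LinearIsometryEquiv.apply_symm_apply,
    LinearIsometryEquiv.apply_symm_apply]

/-- An amplification along a Hilbert sum decomposition is weak-* continuous. -/
theorem continuous_of_isHilbertSum [CompleteSpace K] {ι : Type*} {V : ι → E →ₗᵢ[ℂ] K}
    (hV : IsHilbertSum ℂ (fun _ : ι => E) V) (Φ : (E →L[ℂ] E) → (K →L[ℂ] K))
    (hΦ : ∀ T i x, Φ T (V i x) = V i (T x)) :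
    Continuous[weakStarTopology E, weakStarTopology K] Φ := by
  obtain ⟨U, hU⟩ : ∃ U : K ≃ₗᵢ[ℂ] lp (fun _ : ι => E) 2, ∀ T x i, U (Φ T x) i = T (U x i) :=
    ⟨_, fun T => linearIsometryEquiv_amplification hV T (Φ T) (hΦ T)⟩
  refine continuous_weakStar_iff.2 fun ξ η => ?_
  have hsq : ∀ x : K, HasSum (fun i => ‖U x i‖ ^ 2) (‖x‖ ^ 2) := by
    intro x
    have := lp.hasSum_norm (p := 2) (by simp) (U x)
    simpa using this
  have hs : ∀ ζ : lp (fun _ : ℕ => K) 2, Summable fun p : ℕ × ι => ‖U (ζ p.1) p.2‖ ^ 2 := by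
    intro ζ
    rw [summable_prod_of_nonneg (fun p => by positivity)]
    refine ⟨fun n => (hsq (ζ n)).summable, ?_⟩
    simp_rw [fun n => (hsq (ζ n)).tsum_eq]
    exact summable_sq_lp ζ
  -- In the coordinates U, the pairing of Φ T with (ξ, η) is a pairing of T itself with two square
  -- summable families indexed by ℕ × ι.
  convert continuous_tsum_inner (hs ξ) (hs η) using 2 with T
  rw [(summable_inner_of_summable_sq (summable_sq_clm_apply T (hs ξ)) (hs η)).tsum_prod,
    tracePairing]
  refine tsum_congr fun n => ?_
  rw [← U.inner_map_map, lp.inner_eq_tsum]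
  exact tsum_congr fun i => by rw [hU]

end WeakStar

/-! ### Amplification on an abstract Hilbert space tensor product -/

section Tensor

variable {E H K : Type*} [NormedAddCommGroup E] [InnerProductSpace ℂ E] [CompleteSpace E]
  [NormedAddCommGroup H] [InnerProductSpace ℂ H] [CompleteSpace H]
  [NormedAddCommGroup K] [InnerProductSpace ℂ K] [CompleteSpace K]

/-- If `K` is a Hilbert space tensor product of `E` and `H`, then `T ↦ T ⊗ I` is weak-*
continuous. -/
theorem continuous_of_tensor (τ : E →ₗ[ℂ] H →ₗ[ℂ] K)
    (hτ : ∀ x y u v, ⟪τ x u, τ y v⟫_ℂ = ⟪x, y⟫_ℂ * ⟪u, v⟫_ℂ)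
    (hd : ∀ W : Submodule ℂ K, IsClosed (W : Set K) → (∀ x u, τ x u ∈ W) → W = ⊤)
    (Φ : (E →L[ℂ] E) → (K →L[ℂ] K)) (hΦ : ∀ T x u, Φ T (τ x u) = τ (T x) u) :
    Continuous[weakStarTopology E, weakStarTopology K] Φ := by
  have hnorm : ∀ x u, ‖τ x u‖ = ‖x‖ * ‖u‖ := by
    intro x u
    have h := hτ x x u u
    simp only [inner_self_eq_norm_sq_to_K] at h
    have h' : ‖τ x u‖ ^ 2 = (‖x‖ * ‖u‖) ^ 2 := by rw [mul_pow]; exact_mod_cast h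
    exact (pow_left_inj₀ (norm_nonneg _) (by positivity) two_ne_zero).1 h'
  -- An orthonormal basis of H splits K into the orthogonal copies E ⊗ b i of E, on each of which Φ
  -- T acts as T.
  obtain ⟨w, b, hb⟩ := exists_hilbertBasis ℂ H
  let V : w → E →ₗᵢ[ℂ] K := fun i =>
    { toLinearMap := τ.flip (b i)
      norm_map' := fun x => by simp [hnorm, b.orthonormal.1 i] }
  have hVapp : ∀ i x, V i x = τ x (b i) := fun _ _ => rfl
  refine continuous_of_isHilbertSum (V := V) (IsHilbertSum.mk ?_ ?_) Φ fun T i x => hΦ _ _ _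
  · intro i j hij x y
    rw [hVapp, hVapp, hτ, b.orthonormal.2 hij, mul_zero]
  · rw [top_le_iff]
    refine hd _ (Submodule.isClosed_topologicalClosure _) fun x u => ?_
    set W := (⨆ i, LinearMap.range (V i).toLinearMap).topologicalClosure with hW
    have hWc : IsClosed (W : Set K) := Submodule.isClosed_topologicalClosure _
    let τx : H →L[ℂ] K := (τ x).mkContinuous ‖x‖ fun u => (hnorm x u).le
    -- For fixed x, the vectors u with τ x u in W form a closed subspace containing the basis, hence
    -- all of H.
    have hle : (Submodule.span ℂ (Set.range b)).topologicalClosure ≤ W.comap (τx : H →ₗ[ℂ] K) := by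
      refine Submodule.topologicalClosure_minimal _ (Submodule.span_le.2 ?_)
        (hWc.preimage τx.continuous)
      rintro _ ⟨i, rfl⟩
      exact Submodule.le_topologicalClosure _
        (Submodule.mem_iSup_of_mem i ⟨x, rfl⟩)
    rw [b.dense_span] at hle
    exact hle (Submodule.mem_top (x := u))

end Tensor

/-! ### The ampliation T ⊗ I on L²(ν × ν) -/

section Ampliation

variable {X : Type*} [MeasurableSpace X] {ν : Measure X} [SigmaFinite ν]

theorem submodule_eq_top_of_tensorVec_mem {W : Submodule ℂ (Lp ℂ 2 (ν.prod ν))}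
    (hW : IsClosed (W : Set (Lp ℂ 2 (ν.prod ν)))) (h : ∀ f g, tensorVec f g ∈ W) : W = ⊤ := by
  have h1 : Set.range (tensorIsometry ν) ⊆ W := by
    rintro _ ⟨z, rfl⟩
    induction z using TensorProduct.induction_on with
    | zero => simp
    | add x y hx hy => rw [map_add]; exact W.add_mem hx hy
    | tmul f g => rw [tensorIsometry_tmul]; exact h f g
  rw [eq_top_iff]
  intro z _
  exact closure_minimal h1 hW (denseRange_tensorIsometry ν z)

theorem ext_tensorVec {S T : Lp ℂ 2 (ν.prod ν) →L[ℂ] Lp ℂ 2 (ν.prod ν)}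
    (h : ∀ f g, S (tensorVec f g) = T (tensorVec f g)) : S = T := by
  have : LinearMap.eqLocus (S : Lp ℂ 2 (ν.prod ν) →ₗ[ℂ] Lp ℂ 2 (ν.prod ν)) T = ⊤ :=
    submodule_eq_top_of_tensorVec_mem (isClosed_eq S.continuous T.continuous) h
  ext1 z
  exact (this ▸ Submodule.mem_top : z ∈ LinearMap.eqLocus
    (S : Lp ℂ 2 (ν.prod ν) →ₗ[ℂ] Lp ℂ 2 (ν.prod ν)) T)

variable (ν) in
/-- `(f, g) ↦ f ⊗ g` as a bilinear map. -/
def tensorVecₗ : Lp ℂ 2 ν →ₗ[ℂ] Lp ℂ 2 ν →ₗ[ℂ] Lp ℂ 2 (ν.prod ν) :=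
  (TensorProduct.mk ℂ (Lp ℂ 2 ν) (Lp ℂ 2 ν)).compr₂ (tensorIsometry ν).toLinearMap

theorem tensorVecₗ_apply (f g : Lp ℂ 2 ν) : tensorVecₗ ν f g = tensorVec f g :=
  tensorIsometry_tmul ν f g

theorem continuous_ampliation :
    Continuous[weakStarTopology (Lp ℂ 2 ν), weakStarTopology (Lp ℂ 2 (ν.prod ν))]
      (ampliation : (Lp ℂ 2 ν →L[ℂ] Lp ℂ 2 ν) → _) := by
  refine continuous_of_tensor (tensorVecₗ ν) (fun x y u v => ?_) (fun W hW h => ?_) _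
    fun T x u => ?_
  · simp only [tensorVecₗ_apply, inner_tensorVec]
  · exact submodule_eq_top_of_tensorVec_mem hW fun f g => tensorVecₗ_apply f g ▸ h f g
  · simp only [tensorVecₗ_apply, ampliation_tensorVec]

theorem ampliation_add (S T : Lp ℂ 2 ν →L[ℂ] Lp ℂ 2 ν) :
    ampliation (S + T) = ampliation S + ampliation T :=
  ext_tensorVec fun f g => by
    rw [_root_.add_apply, ampliation_tensorVec, ampliation_tensorVec, ampliation_tensorVec,
      ← tensorVecₗ_apply, ← tensorVecₗ_apply, ← tensorVecₗ_apply, _root_.add_apply, map_add,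
      LinearMap.add_apply]

theorem ampliation_smul (c : ℂ) (T : Lp ℂ 2 ν →L[ℂ] Lp ℂ 2 ν) :
    ampliation (c • T) = c • ampliation T :=
  ext_tensorVec fun f g => by
    rw [_root_.smul_apply, ampliation_tensorVec, ampliation_tensorVec, ← tensorVecₗ_apply,
      ← tensorVecₗ_apply, _root_.smul_apply, map_smul, LinearMap.smul_apply]

theorem ampliation_comp (S T : Lp ℂ 2 ν →L[ℂ] Lp ℂ 2 ν) :
    ampliation (S ∘L T) = ampliation S ∘L ampliation T :=
  ext_tensorVec fun f g => by simp [ampliation_tensorVec]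

/-- The map `f ↦ f ⊗ g`. -/
def tensorRight (g : Lp ℂ 2 ν) : Lp ℂ 2 ν →L[ℂ] Lp ℂ 2 (ν.prod ν) :=
  ((tensorVecₗ ν).flip g).mkContinuous ‖g‖ fun f => by
    have h := inner_tensorVec ν f g f g
    simp only [inner_self_eq_norm_sq_to_K] at h
    have h' : ‖tensorVec f g‖ ^ 2 = (‖g‖ * ‖f‖) ^ 2 := by
      rw [mul_comm ‖g‖, mul_pow]; exact_mod_cast h
    rw [LinearMap.flip_apply, tensorVecₗ_apply]
    exact ((pow_left_inj₀ (norm_nonneg _) (by positivity) two_ne_zero).1 h').le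

theorem tensorRight_apply (g f : Lp ℂ 2 ν) : tensorRight g f = tensorVec f g :=
  tensorVecₗ_apply f g

/-- Slicing with a unit vector g recovers T from T ⊗ I. Being a compression, the slice is weak-*
continuous, which yields the left inverse needed for `image_weakStarSpan`. -/
theorem adjoint_tensorRight_comp_ampliation {g : Lp ℂ 2 ν} (hg : ‖g‖ = 1)
    (T : Lp ℂ 2 ν →L[ℂ] Lp ℂ 2 ν) :
    ContinuousLinearMap.adjoint (tensorRight g) ∘L ampliation T ∘L tensorRight g = T := by
  ext1 f
  refine ext_inner_left ℂ fun k => ?_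
  simp only [ContinuousLinearMap.comp_apply, ContinuousLinearMap.adjoint_inner_right,
    tensorRight_apply, ampliation_tensorVec, inner_tensorVec]
  simp [inner_self_eq_norm_sq_to_K, hg]

end Ampliation

/-! ### Vector-valued L² spaces and averaged matrix coefficients -/

section VectorValued

variable {Ω : Type*} [MeasurableSpace Ω] (P : Measure Ω)
  {E : Type*} [NormedAddCommGroup E] [InnerProductSpace ℂ E] [CompleteSpace E]

/-- `(x, u) ↦ u(·) x`, from `E × L²(P)` to `L²(P; E)`. -/
def smulVecₗ : E →ₗ[ℂ] Lp ℂ 2 P →ₗ[ℂ] Lp E 2 P :=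
  LinearMap.mk₂ ℂ (fun x u => (ContinuousLinearMap.toSpanSingleton ℂ x).compLp u)
    (fun x y u => by
      rw [ContinuousLinearMap.toSpanSingleton_add, ContinuousLinearMap.add_compLp])
    (fun c x u => by
      rw [ContinuousLinearMap.toSpanSingleton_smul, ContinuousLinearMap.smul_compLp])
    (fun x u v => map_add ((ContinuousLinearMap.toSpanSingleton ℂ x).compLpₗ 2 P) u v)
    (fun c x u => map_smul ((ContinuousLinearMap.toSpanSingleton ℂ x).compLpₗ 2 P) c u)

omit [CompleteSpace E] in
theorem smulVecₗ_coeFn (x : E) (u : Lp ℂ 2 P) : smulVecₗ P x u =ᵐ[P] fun r => u r • x :=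
  ContinuousLinearMap.coeFn_compLp _ u

omit [CompleteSpace E] in
theorem inner_smulVecₗ (x y : E) (u v : Lp ℂ 2 P) :
    ⟪smulVecₗ P x u, smulVecₗ P y v⟫_ℂ = ⟪x, y⟫_ℂ * ⟪u, v⟫_ℂ := by
  rw [L2.inner_def, L2.inner_def, ← integral_const_mul]
  refine integral_congr_ae ?_
  filter_upwards [smulVecₗ_coeFn P x u, smulVecₗ_coeFn P y v] with r h1 h2
  rw [h1, h2, inner_smul_left, inner_smul_right, RCLike.inner_apply]
  ring

omit [CompleteSpace E] in
theorem submodule_eq_top_of_smulVecₗ_mem {W : Submodule ℂ (Lp E 2 P)}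
    (hW : IsClosed (W : Set (Lp E 2 P))) (h : ∀ x u, smulVecₗ P x u ∈ W) : W = ⊤ := by
  refine eq_top_iff.2 fun f _ => Lp.induction (by simp) (fun f : Lp E 2 P => f ∈ W) ?_
    (fun f g hf hg _ h1 h2 => W.add_mem h1 h2) hW f
  intro c s hs hμs
  convert h c (indicatorConstLp 2 hs hμs.ne 1) using 1
  rw [Lp.simpleFunc.coe_indicatorConst]
  ext1
  filter_upwards [smulVecₗ_coeFn P c (indicatorConstLp 2 hs hμs.ne 1),
    indicatorConstLp_coeFn (p := 2) (hs := hs) (hμs := hμs.ne) (c := (1 : ℂ)),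
    indicatorConstLp_coeFn (p := 2) (hs := hs) (hμs := hμs.ne) (c := c)] with r h1 h2 h3
  rw [h1, h2, h3]
  by_cases hr : r ∈ s <;> simp [hr]

/-- L²(P; E) is the Hilbert space tensor product of E and L²(P), and pointwise application of T is T
⊗ I there, so `continuous_of_tensor` applies. -/
theorem continuous_compLpL :
    Continuous[weakStarTopology E, weakStarTopology (Lp E 2 P)]
      fun T : E →L[ℂ] E => T.compLpL 2 P := by
  refine continuous_of_tensor (smulVecₗ P) (inner_smulVecₗ P)
    (fun W hW h => submodule_eq_top_of_smulVecₗ_mem P hW h) _ fun T x u => ?_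
  ext1
  filter_upwards [ContinuousLinearMap.coeFn_compLpL T (smulVecₗ P x u), smulVecₗ_coeFn P x u,
    smulVecₗ_coeFn P (T x) u] with r h1 h2 h3
  rw [h1, h2, h3, map_smul]

/-- Averages `∫ ⟪b(r), T a(r)⟫ dP(r)` are weak-* continuous in `T`. -/
theorem continuous_integral_inner {a b : Ω → E} (ha : MemLp a 2 P) (hb : MemLp b 2 P) :
    Continuous[weakStarTopology E, inferInstance]
      fun T : E →L[ℂ] E => ∫ r, ⟪b r, T (a r)⟫_ℂ ∂P := by
  -- The average is a single matrix coefficient of T ⊗ I, between the vectors a and b of L²(P; E).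
  have h := @Continuous.comp _ _ _ (weakStarTopology E) (weakStarTopology (Lp E 2 P)) _ _ _
    (continuous_inner_apply ha.toLp hb.toLp) (continuous_compLpL P)
  convert h using 2 with T
  rw [Function.comp_apply, L2.inner_def]
  refine integral_congr_ae ?_
  filter_upwards [ContinuousLinearMap.coeFn_compLpL T ha.toLp, ha.coeFn_toLp, hb.coeFn_toLp]
    with r h1 h2 h3
  rw [h1, h2, h3]

end VectorValued

/-- `T ↦ C T D` as a linear map. -/
def compressₗ {E F : Type*} [NormedAddCommGroup E] [InnerProductSpace ℂ E]
    [NormedAddCommGroup F] [InnerProductSpace ℂ F] (C : E →L[ℂ] F) (D : F →L[ℂ] E) :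
    (E →L[ℂ] E) →ₗ[ℂ] (F →L[ℂ] F) where
  toFun T := C ∘L T ∘L D
  map_add' S T := by ext; simp
  map_smul' c T := by ext; simp

section Group

variable {G : Type*} [Group G] [TopologicalSpace G] [IsTopologicalGroup G] [LocallyCompactSpace G]
  [SecondCountableTopology G] [MeasurableSpace G] [BorelSpace G]
  (m : Measure G) [IsHaarMeasure m]

omit [BorelSpace G] in
-- Supplies the slicing vector for the left inverse of Γ̃: a normalised indicator of a set of finite
-- positive measure.
theorem exists_norm_eq_one_Lp : ∃ g : Lp ℂ 2 m, ‖g‖ = 1 := by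
  obtain ⟨A, hA, -, h0, htop⟩ := Measure.exists_subset_measure_lt_top (μ := m) (r := 0)
    MeasurableSet.univ (Measure.measure_univ_pos.2 (NeZero.ne m))
  set g := indicatorConstLp 2 hA htop.ne (1 : ℂ) with hg
  have hpos : ‖g‖ ≠ 0 := by
    rw [hg, norm_indicatorConstLp (by simp) (by simp), norm_one, one_mul]
    exact (Real.rpow_pos_of_pos (ENNReal.toReal_pos h0.ne' htop.ne) _).ne'
  exact ⟨((‖g‖ : ℂ)⁻¹) • g, by rw [norm_smul, norm_inv, Complex.norm_real, norm_norm,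
    inv_mul_cancel₀ hpos]⟩

/-! ### The fundamental unitary and the map Γ̃ -/

section Unitary

theorem quasiMeasurePreserving_fundamental_inv :
    QuasiMeasurePreserving (fun p : G × G => (p.1 * p.2⁻¹, p.2)) (m.prod m) (m.prod m) := by
  have hmeas : Measurable fun p : G × G => (p.1 * p.2⁻¹, p.2) := by fun_prop
  refine ⟨hmeas, AbsolutelyContinuous.mk fun s hs h => ?_⟩
  rw [map_apply hmeas hs, prod_apply_symm (hmeas hs), lintegral_eq_zero_iff
    (measurable_measure_prodMk_right (hmeas hs))]
  rw [prod_apply_symm hs, lintegral_eq_zero_iff (measurable_measure_prodMk_right hs)] at h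
  filter_upwards [h] with t ht
  exact (quasiMeasurePreserving_mul_right m t⁻¹).preimage_null ht

theorem map_fundamental_inv :
    map (fun p : G × G => (p.1 * p.2⁻¹, p.2))
      ((m.prod m).withDensity fun p => ((NNReal.sqrt (modularFn p.2⁻¹) : ℝ≥0) : ℝ≥0∞) ^ 2) =
      m.prod m := by
  have hmeas : Measurable fun p : G × G => (p.1 * p.2⁻¹, p.2) := by fun_prop
  simp_rw [coe_sqrt_sq]
  have hΔ : Measurable fun p : G × G => (modularFn p.2⁻¹ : ℝ≥0∞) :=
    (measurable_modularFn.comp measurable_snd.inv).coe_nnreal_ennreal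
  refine Measure.ext_of_lintegral _ fun f hf => ?_
  have hf' : Measurable fun p : G × G => f (p.1 * p.2⁻¹, p.2) := hf.comp hmeas
  rw [lintegral_map hf hmeas, lintegral_withDensity_eq_lintegral_mul _ hΔ hf',
    lintegral_prod_symm' _ (hΔ.mul hf'), lintegral_prod_symm' _ hf]
  refine lintegral_congr fun t => ?_
  simp only [Pi.mul_apply]
  rw [lintegral_const_mul (modularFn t⁻¹ : ℝ≥0∞) (f := fun s => f (s * t⁻¹, t))
    (hf.comp (hmeas.comp measurable_prodMk_right))]
  exact lintegral_mul_right_modularFn m t⁻¹ (fun s => f (s, t))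
    (hf.comp measurable_prodMk_right)

omit [SecondCountableTopology G] [MeasurableSpace G] [BorelSpace G] in
theorem sqrt_modularFn_mul_inv (t : G) :
    ((NNReal.sqrt (modularFn t) : ℝ) : ℂ) * ((NNReal.sqrt (modularFn t⁻¹) : ℝ) : ℂ) = 1 := by
  have h := map_mul (modularCharacter (G := G)) t⁻¹ t
  rw [inv_mul_cancel, map_one] at h
  have h3 : NNReal.sqrt (modularFn t) * NNReal.sqrt (modularFn t⁻¹) = 1 := by
    rw [← NNReal.sqrt_mul, modularFn, modularFn, inv_inv, ← h, NNReal.sqrt_one]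
  exact_mod_cast h3

/-- The preimage of η is (s, t) ↦ Δ(t)^{-1/2} η(st⁻¹, t). The isometry property alone gives only V*V
= I; surjectivity gives VV* = I. -/
theorem fundamentalUnitary_surjective : Function.Surjective (fundamentalUnitary m) := by
  intro η
  have hw : Measurable fun p : G × G => NNReal.sqrt (modularFn p.2⁻¹) :=
    NNReal.continuous_sqrt.measurable.comp (measurable_modularFn.comp measurable_snd.inv)
  refine ⟨weightedComp _ _ (quasiMeasurePreserving_fundamental_inv m) hw
    (map_fundamental_inv m) η, ?_⟩
  ext1
  filter_upwards [fundamentalUnitary_coeFn m (weightedComp _ _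
      (quasiMeasurePreserving_fundamental_inv m) hw (map_fundamental_inv m) η),
    (quasiMeasurePreserving_fundamental m).ae (weightedComp_coeFn
      (quasiMeasurePreserving_fundamental_inv m) hw (map_fundamental_inv m) η)] with p h1 h2
  rw [h1, h2, ← mul_assoc, sqrt_modularFn_mul_inv, one_mul]
  simp

theorem adjoint_fundamentalUnitary_apply (ξ : Lp ℂ 2 (m.prod m)) :
    ContinuousLinearMap.adjoint (fundamentalUnitary m) (fundamentalUnitary m ξ) = ξ :=
  DFunLike.congr_fun ((ContinuousLinearMap.norm_map_iff_adjoint_comp_self _).1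
    (fundamentalUnitary_norm m)) ξ

theorem fundamentalUnitary_adjoint_apply (ξ : Lp ℂ 2 (m.prod m)) :
    fundamentalUnitary m (ContinuousLinearMap.adjoint (fundamentalUnitary m) ξ) = ξ := by
  obtain ⟨η, rfl⟩ := fundamentalUnitary_surjective m ξ
  rw [adjoint_fundamentalUnitary_apply]

theorem measurePreserving_mul_left_fst (s : G) :
    MeasurePreserving (fun p : G × G => (s * p.1, p.2)) (m.prod m) (m.prod m) :=
  (measurePreserving_mul_left m s).prod (MeasurePreserving.id m)

/-- The ampliation is defined by continuous extension; agreement with the translation in the first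
variable on elementary tensors gives its pointwise formula on all of L². -/
theorem ampliation_leftReg_coeFn (s : G) (ζ : Lp ℂ 2 (m.prod m)) :
    ampliation (leftReg m s) ζ =ᵐ[m.prod m] fun p => ζ (s⁻¹ * p.1, p.2) := by
  have hmp := measurePreserving_mul_left_fst m s⁻¹
  have : ampliation (leftReg m s) =
      (Lp.compMeasurePreservingₗᵢ ℂ _ hmp).toContinuousLinearMap := by
    refine ext_tensorVec fun f g => ?_
    rw [ampliation_tensorVec]
    ext1
    refine EventuallyEq.trans ?_ (Lp.coeFn_compMeasurePreserving (tensorVec f g) hmp).symm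
    filter_upwards [tensorVec_coeFn m (leftReg m s f) g,
      hmp.quasiMeasurePreserving.ae (tensorVec_coeFn m f g),
      quasiMeasurePreserving_fst.ae (leftReg_coeFn m s f)] with p h1 h2 h3
    rw [h1, h3, Function.comp_apply, h2]
  rw [this]
  exact Lp.coeFn_compMeasurePreserving ζ hmp

theorem ampliation_mulOp_coeFn {X : Type*} [MeasurableSpace X] {ν : Measure X} [SigmaFinite ν]
    (φ : Lp ℂ ∞ ν) (ζ : Lp ℂ 2 (ν.prod ν)) :
    ampliation (mulOp φ) ζ =ᵐ[ν.prod ν] fun p => φ p.1 * ζ p := by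
  have hb : ∀ᵐ x ∂ν, ‖φ x‖ ≤ ‖φ‖ := by
    filter_upwards [ae_le_eLpNormEssSup (f := φ) (μ := ν)] with x hx
    rw [Lp.norm_def, eLpNorm_exponent_top, ← toReal_enorm]
    refine ENNReal.toReal_mono ?_ hx
    rw [← eLpNorm_exponent_top]
    exact (Lp.memLp φ).2.ne
  have hφ : MemLp (fun p : X × X => φ p.1) ∞ (ν.prod ν) :=
    memLp_top_of_bound ((Lp.memLp φ).1.comp_fst) ‖φ‖ (quasiMeasurePreserving_fst.ae hb)
  have : ampliation (mulOp φ) = mulOp hφ.toLp := by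
    refine ext_tensorVec fun f g => ?_
    rw [ampliation_tensorVec]
    ext1
    filter_upwards [tensorVec_coeFn ν (mulOp φ f) g, tensorVec_coeFn ν f g,
      quasiMeasurePreserving_fst.ae (mulOp_coeFn φ f), mulOp_coeFn hφ.toLp (tensorVec f g),
      hφ.coeFn_toLp] with p h1 h2 h3 h4 h5
    rw [h1, h3, h4, h5, h2, mul_assoc]
  rw [this]
  filter_upwards [mulOp_coeFn hφ.toLp ζ, hφ.coeFn_toLp] with p h1 h2
  rw [h1, h2]

/-- Left translation of s commutes with s ↦ st, and the weight Δ(t)^{1/2} does not involve s. -/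
theorem fundamentalUnitary_comp_ampliation_leftReg (s : G) :
    fundamentalUnitary m ∘L ampliation (leftReg m s) =
      ampliation (leftReg m s) ∘L fundamentalUnitary m := by
  ext1 ζ
  ext1
  simp only [ContinuousLinearMap.comp_apply]
  filter_upwards [fundamentalUnitary_coeFn m (ampliation (leftReg m s) ζ),
    (quasiMeasurePreserving_fundamental m).ae (ampliation_leftReg_coeFn m s ζ),
    ampliation_leftReg_coeFn m s (fundamentalUnitary m ζ),
    (measurePreserving_mul_left_fst m s⁻¹).quasiMeasurePreserving.ae
      (fundamentalUnitary_coeFn m ζ)] with p h1 h2 h3 h4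
  rw [h1, h2, h3, h4, mul_assoc s⁻¹]

theorem fundamentalUnitary_comp_ampliation_mulOp (φ : Lp ℂ ∞ m) :
    fundamentalUnitary m ∘L ampliation (mulOp φ) =
      mulOp (alphaTilde m φ) ∘L fundamentalUnitary m := by
  ext1 ζ
  ext1
  simp only [ContinuousLinearMap.comp_apply]
  filter_upwards [fundamentalUnitary_coeFn m (ampliation (mulOp φ) ζ),
    (quasiMeasurePreserving_fundamental m).ae (ampliation_mulOp_coeFn φ ζ),
    mulOp_coeFn (alphaTilde m φ) (fundamentalUnitary m ζ), alphaTilde_coeFn m φ,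
    fundamentalUnitary_coeFn m ζ] with p h1 h2 h3 h4 h5
  rw [h1, h2, h3, h4, h5, mul_left_comm]

/-- The two intertwining relations move V to the right past M_φ ⊗ I and λ_s ⊗ I, where it cancels
against V*. -/
theorem gammaTilde_mulOp_comp_leftReg (φ : Lp ℂ ∞ m) (s : G) :
    gammaTilde m (mulOp φ ∘L leftReg m s) =
      mulOp (alphaTilde m φ) ∘L ampliation (leftReg m s) := by
  ext1 ζ
  have h1 := fun x => DFunLike.congr_fun (fundamentalUnitary_comp_ampliation_mulOp m φ) x
  have h2 := fun x => DFunLike.congr_fun (fundamentalUnitary_comp_ampliation_leftReg m s) x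
  simp only [ContinuousLinearMap.comp_apply] at h1 h2
  simp only [gammaTilde, ampliation_comp, ContinuousLinearMap.comp_apply, h1, h2,
    fundamentalUnitary_adjoint_apply]

/-- `Γ̃` as a linear map. -/
def gammaTildeₗ : (Lp ℂ 2 m →L[ℂ] Lp ℂ 2 m) →ₗ[ℂ]
    (Lp ℂ 2 (m.prod m) →L[ℂ] Lp ℂ 2 (m.prod m)) :=
  compressₗ (fundamentalUnitary m) (ContinuousLinearMap.adjoint (fundamentalUnitary m)) ∘ₗ
    { toFun := ampliation
      map_add' := ampliation_add
      map_smul' := ampliation_smul }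

theorem gammaTilde_image_weakStarSpan (S : Set (Lp ℂ 2 m →L[ℂ] Lp ℂ 2 m)) :
    gammaTilde m '' weakStarSpan S = weakStarSpan (gammaTilde m '' S) := by
  obtain ⟨g, hg⟩ := exists_norm_eq_one_Lp m
  set V := fundamentalUnitary m with hV
  refine image_weakStarSpan (gammaTildeₗ m) ?_
    -- The left inverse: undo the conjugation by V, then slice the second factor with g.
    (fun S => (ContinuousLinearMap.adjoint (tensorRight g) ∘L ContinuousLinearMap.adjoint V) ∘L
      S ∘L (V ∘L tensorRight g)) (continuous_compress _ _) ?_ S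
  · exact @Continuous.comp _ _ _ (weakStarTopology _) (weakStarTopology _) (weakStarTopology _)
      ampliation (fun T => V ∘L T ∘L ContinuousLinearMap.adjoint V) (continuous_compress _ _)
      continuous_ampliation
  · intro T
    conv_rhs => rw [← adjoint_tensorRight_comp_ampliation hg T]
    ext1 f
    change ContinuousLinearMap.adjoint (tensorRight g) (ContinuousLinearMap.adjoint V
      (V (ampliation T (ContinuousLinearMap.adjoint V (V (tensorRight g f)))))) = _
    rw [hV, adjoint_fundamentalUnitary_apply, adjoint_fundamentalUnitary_apply]
    rfl

end Unitary

/-! ### Covariance and generators of the bimodule -/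

section Bimodule

theorem leftReg_one : leftReg m (1 : G) = ContinuousLinearMap.id ℂ _ := by
  ext1 f
  ext1
  filter_upwards [leftReg_coeFn m 1 f] with x h
  rw [h, inv_one, one_mul, ContinuousLinearMap.id_apply]

theorem leftReg_mul (s t : G) : leftReg m s ∘L leftReg m t = leftReg m (s * t) := by
  ext1 f
  ext1
  rw [ContinuousLinearMap.comp_apply]
  filter_upwards [leftReg_coeFn m s (leftReg m t f), leftReg_coeFn m (s * t) f,
    (measurePreserving_mul_left m s⁻¹).quasiMeasurePreserving.ae (leftReg_coeFn m t f)]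
    with x h1 h2 h3
  rw [h1, h2, h3, mul_inv_rev, mul_assoc]

/-- The covariance relation: translations can be collected to the right of a multiplication operator
at the cost of translating its symbol. -/
theorem leftReg_comp_mulOp (s : G) (φ : Lp ℂ ∞ m) :
    leftReg m s ∘L mulOp φ = mulOp (leftTranslate s φ) ∘L leftReg m s := by
  ext1 f
  ext1
  simp only [ContinuousLinearMap.comp_apply]
  filter_upwards [leftReg_coeFn m s (mulOp φ f), mulOp_coeFn (leftTranslate s φ) (leftReg m s f),
    leftReg_coeFn m s f, leftTranslate_coeFn m s φ,
    (measurePreserving_mul_left m s⁻¹).quasiMeasurePreserving.ae (mulOp_coeFn φ f)]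
    with x h1 h2 h3 h4 h5
  rw [h1, h2, h3, h4, h5]

/-- The `VN(G)`-bimodule generated by a left translation invariant space `U ⊆ L^∞(G)` is the
weak-* closed span of the operators `M_φ λ_s`. -/
theorem bimodule_eq_weakStarSpan {U : Set (Lp ℂ ∞ m)}
    (hU : ∀ s : G, ∀ φ ∈ U, leftTranslate s φ ∈ U) :
    bimodule m U = weakStarSpan {T | ∃ φ ∈ U, ∃ s : G, T = mulOp φ ∘L leftReg m s} := by
  set S := {T | ∃ φ ∈ U, ∃ s : G, T = mulOp φ ∘L leftReg m s} with hS
  refine Set.Subset.antisymm ?_ ?_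
  · refine weakStarSpan_subset (W := weakStarSpanSubmodule S) ?_ (isClosed_weakStarSpan S)
    rintro _ ⟨A, hA, B, hB, φ, hφ, rfl⟩
    -- Only separate weak-* continuity of multiplication is used: A ranges over VN(G) with B = λ_t
    -- fixed, and afterwards B ranges with A fixed.
    have h1 : ∀ t : G, A ∘L (mulOp φ ∘L leftReg m t) ∈ weakStarSpan S := by
      intro t
      refine map_weakStarSpan_subset
        (compressₗ (ContinuousLinearMap.id ℂ _) (mulOp φ ∘L leftReg m t))
        (continuous_compress _ _) ?_ hA
      rintro _ ⟨s, rfl⟩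
      refine subset_weakStarSpan S ⟨_, hU s φ hφ, s * t, ?_⟩
      change leftReg m s ∘L mulOp φ ∘L leftReg m t = _
      rw [← leftReg_mul, ← ContinuousLinearMap.comp_assoc, leftReg_comp_mulOp,
        ContinuousLinearMap.comp_assoc]
    refine map_weakStarSpan_subset (compressₗ (A ∘L mulOp φ) (ContinuousLinearMap.id ℂ _))
      (continuous_compress _ _) ?_ hB
    rintro _ ⟨t, rfl⟩
    exact h1 t
  · refine weakStarSpan_subset (W := weakStarSpanSubmodule _) ?_ (isClosed_weakStarSpan _)
    rintro _ ⟨φ, hφ, s, rfl⟩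
    refine subset_weakStarSpan _ ⟨leftReg m 1, subset_weakStarSpan _ ⟨1, rfl⟩, leftReg m s,
      subset_weakStarSpan _ ⟨s, rfl⟩, φ, hφ, ?_⟩
    rw [leftReg_one, ContinuousLinearMap.id_comp]

end Bimodule

/-! ### Harmonic operators -/

section Harmonic

variable (μ : Measure G) [IsProbabilityMeasure μ]

theorem theta_apply (T : Lp ℂ 2 m →L[ℂ] Lp ℂ 2 m) (ξ : Lp ℂ 2 m) :
    theta m μ T ξ = ∫ r, adRho r T ξ ∂μ := rfl

theorem inner_theta (T : Lp ℂ 2 m →L[ℂ] Lp ℂ 2 m) (ξ η : Lp ℂ 2 m) :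
    ⟪η, theta m μ T ξ⟫_ℂ = ∫ r, ⟪rightReg m r⁻¹ η, T (rightReg m r⁻¹ ξ)⟫_ℂ ∂μ := by
  refine ((innerSL ℂ η).integral_comp_comm (integrable_adRho m μ T ξ)).symm.trans ?_
  refine integral_congr_ae (Eventually.of_forall fun r => ?_)
  simp only [innerSL_apply_apply, adRho, ContinuousLinearMap.comp_apply, adjoint_rightReg]
  rw [← ContinuousLinearMap.adjoint_inner_left, adjoint_rightReg]

theorem memLp_rightReg_inv (ξ : Lp ℂ 2 m) : MemLp (fun r => rightReg m r⁻¹ ξ) 2 μ :=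
  MemLp.of_bound ((stronglyMeasurable_rightReg m ξ).comp_measurable
    measurable_inv).aestronglyMeasurable ‖ξ‖
    (Eventually.of_forall fun r => (rightReg_norm m r⁻¹ ξ).le)

/-- Weak-* limits run along nets, so dominated convergence is not available. Instead r ↦ ρ_{r⁻¹} ξ
is bounded and strongly measurable, hence in L²(μ; L²(G)), and `continuous_integral_inner` applies.
-/
theorem continuous_inner_theta (ξ η : Lp ℂ 2 m) :
    Continuous[weakStarTopology (Lp ℂ 2 m), inferInstance]
      fun T : Lp ℂ 2 m →L[ℂ] Lp ℂ 2 m => ⟪η, theta m μ T ξ⟫_ℂ := by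
  simp_rw [inner_theta]
  exact continuous_integral_inner μ (memLp_rightReg_inv m μ ξ) (memLp_rightReg_inv m μ η)

/-- The space of `μ`-harmonic operators as a submodule. -/
def harmonicSubmodule : Submodule ℂ (Lp ℂ 2 m →L[ℂ] Lp ℂ 2 m) where
  carrier := harmonicOperators m μ
  zero_mem' := by
    ext1 ξ
    simp [theta_apply, adRho]
  add_mem' := fun {S T} hS hT => by
    ext1 ξ
    have h1 : theta m μ S ξ = S ξ := DFunLike.congr_fun hS ξ
    have h2 : theta m μ T ξ = T ξ := DFunLike.congr_fun hT ξ
    rw [_root_.add_apply, ← h1, ← h2, theta_apply, theta_apply, theta_apply,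
      ← integral_add (integrable_adRho m μ S ξ) (integrable_adRho m μ T ξ)]
    simp [adRho]
  smul_mem' := fun c T hT => by
    ext1 ξ
    have h1 : theta m μ T ξ = T ξ := DFunLike.congr_fun hT ξ
    rw [_root_.smul_apply, ← h1, theta_apply, theta_apply, ← integral_smul]
    simp [adRho]

/-- Equality Θ(μ)(T) = T is tested on matrix coefficients, and both sides of each such equation are
weak-* continuous in T. -/
theorem isClosed_harmonicOperators :
    IsClosed[weakStarTopology (Lp ℂ 2 m)] (harmonicOperators m μ) := by
  let := weakStarTopology (Lp ℂ 2 m)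
  have : harmonicOperators m μ = ⋂ (ξ : Lp ℂ 2 m) (η : Lp ℂ 2 m),
      {T | ⟪η, theta m μ T ξ⟫_ℂ = ⟪η, T ξ⟫_ℂ} := by
    ext T
    simp only [Set.mem_iInter, Set.mem_ofPred_eq]
    refine ⟨fun h ξ η => by rw [show theta m μ T = T from h], fun h => ?_⟩
    exact ContinuousLinearMap.ext fun ξ => ext_inner_left ℂ fun η => h ξ η
  rw [this]
  exact isClosed_iInter fun ξ => isClosed_iInter fun η =>
    isClosed_eq (continuous_inner_theta m μ ξ η) (continuous_inner_apply ξ η)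

/-- Left and right translations commute, so conjugation by ρ_r only replaces φ by φ(·r); the factors
Δ(r)^{1/2} and Δ(r⁻¹)^{1/2} cancel. -/
theorem adRho_mulOp_comp_leftReg_coeFn (r s : G) (φ : Lp ℂ ∞ m) (ξ : Lp ℂ 2 m) :
    adRho r (mulOp φ ∘L leftReg m s) ξ =ᵐ[m] fun x => φ (x * r) * leftReg m s ξ x := by
  simp only [adRho, adjoint_rightReg, ContinuousLinearMap.comp_apply]
  have hr := quasiMeasurePreserving_mul_right m r
  have hs := (measurePreserving_mul_left m s⁻¹).quasiMeasurePreserving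
  filter_upwards [rightReg_coeFn m r (mulOp φ (leftReg m s (rightReg m r⁻¹ ξ))),
    hr.ae (mulOp_coeFn φ (leftReg m s (rightReg m r⁻¹ ξ))),
    hr.ae (leftReg_coeFn m s (rightReg m r⁻¹ ξ)),
    hr.ae (hs.ae (rightReg_coeFn m r⁻¹ ξ)), leftReg_coeFn m s ξ] with x h1 h2 h3 h4 h5
  rw [h1, h2, h3, h4, h5, mul_left_comm, ← mul_assoc (_ : ℂ) _ (ξ _), sqrt_modularFn_mul_inv,
    one_mul, ← mul_assoc s⁻¹, mul_inv_cancel_right]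

/-- Averaging the previous formula over μ turns the symbol φ into P_μ φ = φ. Fubini is legitimate on
matrix coefficients: φ is bounded, ζ times the conjugate of η is integrable on G, and μ is finite.
-/
theorem mulOp_comp_leftReg_mem_harmonicOperators {φ : Lp ℂ ∞ m}
    (hφ : φ ∈ harmonicFunctions m μ) (s : G) :
    mulOp φ ∘L leftReg m s ∈ harmonicOperators m μ := by
  refine ContinuousLinearMap.ext fun ξ => ext_inner_left ℂ fun η => ?_
  set ζ := leftReg m s ξ with hζ
  have hq := quasiMeasurePreserving_mul_prod m μ
  have hint : Integrable (fun p : G × G => φ (p.1 * p.2) * (ζ p.1 * (starRingEnd ℂ) (η p.1)))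
      (m.prod μ) := by
    have h1 : Integrable (fun x => ζ x * (starRingEnd ℂ) (η x)) m := by
      simpa only [RCLike.inner_apply] using L2.integrable_inner (𝕜 := ℂ) η ζ
    exact (h1.comp_fst μ).bdd_mul ((Lp.memLp φ).1.comp_quasiMeasurePreserving hq)
      (hq.ae (ae_norm_le φ))
  have hP : (fun x => ∫ t, φ (x * t) ∂μ) =ᵐ[m] φ := by
    have := poissonOp_coeFn m μ φ
    rw [show poissonOp m μ φ = φ from hφ] at this
    exact this.symm
  calc ⟪η, theta m μ (mulOp φ ∘L leftReg m s) ξ⟫_ℂ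
      = ∫ r, ⟪η, adRho r (mulOp φ ∘L leftReg m s) ξ⟫_ℂ ∂μ :=
        ((innerSL ℂ η).integral_comp_comm (integrable_adRho m μ _ ξ)).symm
    _ = ∫ r, ∫ x, φ (x * r) * (ζ x * (starRingEnd ℂ) (η x)) ∂m ∂μ := by
        refine integral_congr_ae (Eventually.of_forall fun r => ?_)
        dsimp only
        rw [L2.inner_def]
        refine integral_congr_ae ?_
        filter_upwards [adRho_mulOp_comp_leftReg_coeFn m r s φ ξ] with x hx
        rw [hx, RCLike.inner_apply, mul_assoc]
    _ = ∫ x, ∫ r, φ (x * r) * (ζ x * (starRingEnd ℂ) (η x)) ∂μ ∂m :=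
        (integral_integral_swap (f := fun x r => φ (x * r) * (ζ x * (starRingEnd ℂ) (η x)))
          hint).symm
    _ = ⟪η, (mulOp φ ∘L leftReg m s) ξ⟫_ℂ := by
        rw [L2.inner_def]
        refine integral_congr_ae ?_
        filter_upwards [hP, mulOp_coeFn φ ζ] with x h1 h2
        rw [integral_mul_const, h1, ContinuousLinearMap.comp_apply, ← hζ, h2, RCLike.inner_apply,
          mul_assoc]

end Harmonic

end Group

end HarmonicCrossed

end

theorem mainTheorem8 {G : Type*} [Group G] [TopologicalSpace G] [IsTopologicalGroup G]
    [T2Space G] [LocallyCompactSpace G] [SecondCountableTopology G]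
    [MeasurableSpace G] [BorelSpace G]
    (m : MeasureTheory.Measure G) [m.IsHaarMeasure]
    (μ : MeasureTheory.Measure G) [MeasureTheory.IsProbabilityMeasure μ] :
    gammaTilde m '' bimodule m (harmonicFunctions m μ) =
        crossedProduct m (harmonicFunctions m μ) ∧
      crossedProduct m (harmonicFunctions m μ) ⊆ gammaTilde m '' harmonicOperators m μ := by
  have hbim : bimodule m (harmonicFunctions m μ) =
      weakStarSpan {T | ∃ φ ∈ harmonicFunctions m μ, ∃ s : G, T = mulOp φ ∘L leftReg m s} :=
    bimodule_eq_weakStarSpan m fun s _ hφ => leftTranslate_mem_harmonicFunctions m μ s hφ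
  have heq : gammaTilde m '' bimodule m (harmonicFunctions m μ) =
      crossedProduct m (harmonicFunctions m μ) := by
    rw [hbim, gammaTilde_image_weakStarSpan, crossedProduct]
    -- Both sides are now closed spans, and Γ̃ matches their generating sets element by element.
    congr 1
    ext T
    constructor
    · rintro ⟨_, ⟨φ, hφ, s, rfl⟩, rfl⟩
      exact ⟨φ, hφ, s, gammaTilde_mulOp_comp_leftReg m φ s⟩
    · rintro ⟨φ, hφ, s, rfl⟩
      exact ⟨_, ⟨φ, hφ, s, rfl⟩, gammaTilde_mulOp_comp_leftReg m φ s⟩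
  refine ⟨heq, ?_⟩
  -- By the equality just proved, the inclusion is the image under Γ̃ of Bim(H(μ)) ⊆ H̃(μ), which is
  -- checked on the generators M_φ λ_s.
  rw [← heq, hbim]
  refine Set.image_mono (weakStarSpan_subset (W := harmonicSubmodule m μ) ?_
    (isClosed_harmonicOperators m μ))
  rintro _ ⟨φ, hφ, s, rfl⟩
  exact mulOp_comp_leftReg_mem_harmonicOperators m μ hφ s
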